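/- **Setting.** Let $\pi=(\pi_n)$ be a sequence of finite partitions $0=t^n_0<\dots<t^n_{k_n}$ with $t^n_{k_n}\to\infty$ and mesh vanishing on compacts. For a càdlàg path $x:[0,\infty)\to\mathbb R^m$ (with $x(0-):=x(0)$) let $x_t=x(\cdot\wedge t)$, let $x_{t-}$ be equal to $x$ on $[0,t)$ and to $x(t-)$ on $[t,\infty)$, and let $x^n=\sum_i x(t^n_{i+1})1_{[t^n_i,t^n_{i+1})}$. The path $x$ has finite quadratic variation $[x]$ along $\pi$ if $t\mapsto\sum_{\pi_n\ni t_i\le t}(x(t_{i+1})-x(t_i))(x(t_{i+1})-x(t_i))'$ converges to $[x]$ in the Skorokhod $J_1$ topology. Let $\Omega$ be a non-empty set of càdlàg paths of finite quadratic variation along $\pi$ that is generic: for $x\in\Omega$ and $T>0$, $(x^n)_T\in\Omega$ for all large $n$; and for $x\in\Omega$, $t\ge0$ there is a convex neighbourhood $\mathcal U$ of $0$ with $-\Delta x(t)\in\mathcal U$ and $x_t+e1_{[t,\infty)}\in\Omega$ for all $e\in\mathcal U$. Put $\Lambda=\{(t,x_t):t\ge0,\ x\in\Omega\}$. For $t\ge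 0$ let $t_n'=\max\{t_i\in\pi_n:t_i<t\}$ (with $\max\emptyset=0$). A functional $F$ on $\Lambda$ is *left-continuous* if, for all $x\in\Omega$ and $t\ge 0$, $F(t,x_{t-})$ is the limit of $F(s,x_{s-})$ as $s\uparrow t$, $s\le t$; of $F(s,x_s)$ as $s\uparrow t$, $s<t$; of $F(t_n,x^n_{t_n-})$ whenever $t_n\to t$, $t_n\le t_n'$; and of $F(t_n,x^n_{t_n})$ whenever $t_n\to t$, $t_n<t'_n$. It is *right-continuous* if $F(t,x_t)$ is the limit of $F(s,x_s)$ as $s\downarrow t$, $s\ge t$; of $F(s,x_{s-})$ as $s\downarrow t$, $s>t$; of $F(t_n,x^n_{t_n})$ whenever $t_n\to t$, $t_n\ge t_n'$; and of $F(t_n,x^n_{t_n-})$ whenever $t_n\to t$, $t_n>t_n'$. The $\pi$-topology on $\Lambda$ is the initial topology of all real functionals that are both left- and right-continuous, and $C_\pi(\Lambda)$ is the space of real functionals continuous for it. $F$ is *strictly causal* if $F(t,x_t)=F(t,x_{t-})$, and *locally bounded* if for all $x\in\Omega$, $T\ge0$ the maps $t\mapsto F(t,x^n_t)$ are bounded on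 $[0,T]$ uniformly over all large $n$. The horizontal derivative is $\mathcal DF(t,x_t)=\lim_{h\downarrow0}(F(t+h,x_t)-F(t,x_t))/h$, and the vertical derivative $\nabla_xF(t,x_t)$ is the gradient at $e=0$ of $e\mapsto F(t,x_t+e1_{[t,\infty)})$. $\mathcal M_b(\Lambda)$ is the set of $F\in C_\pi(\Lambda)$ that are horizontally and vertically differentiable, with $\mathcal DF=0$ and with $\nabla_xF$ left-continuous, strictly causal and locally bounded; $\mathfrak L_b(\Lambda)=\{\nabla_xF:F\in\mathcal M_b(\Lambda)\}$. For $\phi,\psi\in\mathfrak L_b(\Lambda)$ define the functionals $$\Big(\int\phi\,dx\Big)(t,x_t)=\lim_n\sum_{\pi_n\ni t_i\le t}\phi(t_i,x^n_{t_i-})\cdot(x(t_{i+1})-x(t_i)),\qquad \Big(\int\phi\psi'd[x]\Big)(t,x_t)=\sum_{i,j}\int_{(0,t]}\phi_i(s,x_{s-})\psi_j(s,x_{s-})\,d[x]_{ij}(s)$$ (the latter with Lebesgue–Stieltjes integrals), and the bracket $\{\phi,\psi\}(t,x_t)=\big(\psi\int\phi\,dx+\phi\int\psi\,dx\big)(t,x_{t-})$.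 **Statement.** Let $\mathcal E\subset\mathfrak L_b(\Lambda)$ be a linear subspace with $\{\phi,\psi\}\in\mathcal E$ for all $\phi,\psi\in\mathcal E$, let $\mathbf I(\mathcal E)=\{\int\phi\,dx:\phi\in\mathcal E\}$, and let $\mathbb E$ be a linear functional on $C_\pi(\Lambda)$ that is positive ($F\ge0$ implies $\mathbb E(F)\ge0$) and vanishes on $\mathbf I(\mathcal E)$. For $\phi,\psi\in\mathcal E$ the limits and integrals defining $\int\phi\,dx$ and $\int\phi\psi'd[x]$ exist, these functionals belong to $C_\pi(\Lambda)$ and depend linearly, respectively bilinearly, on $\phi$ and $\psi$; $\mathbf I(\mathcal E)$ is a linear subspace of $C_\pi(\Lambda)$, and $$\Big\langle\int\phi\,dx,\int\psi\,dx\Big\rangle_{\mathbf I(\mathcal E)}:=\mathbb E\Big(\int\phi\,dx\int\psi\,dx\Big)=\mathbb E\Big(\int\phi\psi'\,d[x]\Big)=:\langle\phi,\psi\rangle_{\mathcal E}.$$ Both brackets induce seminorms $\langle\cdot,\cdot\rangle^{1/2}$. Let $\tilde{\mathcal E}$ and $\mathbf I(\tilde{\mathcal E})$ be the quotients of $\mathcal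 E$ and $\mathbf I(\mathcal E)$ by the null spaces of these seminorms. The brackets define inner products on the quotients, and $\tilde\phi\mapsto\widetilde{\int\phi\,dx}$ is a well-defined isometric linear isomorphism from the pre-Hilbert space $\tilde{\mathcal E}$ onto the pre-Hilbert space $\mathbf I(\tilde{\mathcal E})$. Its inverse is induced by the vertical derivative: every $F\in\mathbf I(\mathcal E)$ belongs to $\mathcal M_b(\Lambda)$, there is $\phi\in\mathcal E$ with $\phi(t,x_t)=\nabla_xF(t,x_t)$ for all $(t,x_t)\in\Lambda$ with $t>0$, and for every such $\phi$ the inverse maps $\tilde F$ to $\tilde\phi$. -/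

import Mathlib

open Set Filter Topology MeasureTheory
open scoped NNReal

noncomputable section

namespace PathwiseCalculus

/-! ## Paths and partitions -/

/-- Euclidean space `ℝ^m`. -/
abbrev Vec (m : ℕ) : Type := EuclideanSpace ℝ (Fin m)

/-- Functions `[0,∞) → ℝ^m`; the càdlàg ones are singled out by `IsCadlag`. -/
abbrev Path (m : ℕ) : Type := ℝ≥0 → Vec m

/-- Right-continuous with left limits. -/
def IsCadlag {V : Type*} [TopologicalSpace V] (x : ℝ≥0 → V) : Prop :=
  ∀ t, ContinuousWithinAt x (Ici t) t ∧ ∃ l, Tendsto x (𝓝[<] t) (𝓝 l)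

/-- The stopped path `x_t = x(· ∧ t)`. -/
def stopAt {m : ℕ} (x : Path m) (t : ℝ≥0) : Path m := fun s => x (min s t)

/-- The path `x_{t-}`, equal to `x` before `t` and to `x(t-)` from `t` on; here `x(0-) = x(0)`,
which is the value of `Function.leftLim x 0`. -/
def stopLeft {m : ℕ} (x : Path m) (t : ℝ≥0) : Path m :=
  fun s => if s < t then x s else Function.leftLim x t

/-- The jump `Δx(t) = x(t) - x(t-)`. -/
def jump {m : ℕ} (x : Path m) (t : ℝ≥0) : Vec m := x t - Function.leftLim x t

/-- The vertically perturbed path `x_t + e 1_{[t,∞)}`. -/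
def bump {m : ℕ} (x : Path m) (t : ℝ≥0) (e : Vec m) : Path m :=
  fun s => stopAt x t s + if t ≤ s then e else 0

/-- The last point of a finite partition. -/
def lastPt (P : Finset ℝ≥0) : ℝ≥0 := P.sup id

/-- The first partition point strictly after `t`; the last partition point if there is none.
For `t = t_i` this is `t_{i+1}`. -/
def nextPt (P : Finset ℝ≥0) (t : ℝ≥0) : ℝ≥0 :=
  if h : (P.filter (fun s => t < s)).Nonempty then (P.filter (fun s => t < s)).min' h else lastPt P

/-- `max {s ∈ P | s < t}`, with the convention `max ∅ = 0`. -/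
def prevPt (P : Finset ℝ≥0) (t : ℝ≥0) : ℝ≥0 := (P.filter (fun s => s < t)).sup id

/-- A sequence of finite partitions `0 = t_0 < ... < t_k` with `t_k → ∞` and mesh vanishing on
compacts. -/
structure IsPartitionSeq (π : ℕ → Finset ℝ≥0) : Prop where
  zero_mem : ∀ n, 0 ∈ π n
  last_tendsto : Tendsto (fun n => lastPt (π n)) atTop atTop
  mesh : ∀ T : ℝ≥0, ∀ ε : ℝ, 0 < ε →
    ∀ᶠ n in atTop, ∀ s ∈ π n, s ≤ T → (nextPt (π n) s : ℝ) - s < ε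

/-- The piecewise constant approximation `∑ x(t_{i+1}) 1_{[t_i, t_{i+1})}`. -/
def pcApprox {m : ℕ} (P : Finset ℝ≥0) (x : Path m) : Path m :=
  fun t => if t < lastPt P then x (nextPt P t) else 0

/-! ## Quadratic variation along a sequence of partitions -/

/-- Convergence in the Skorokhod J₁ topology on `[0,∞)`, through time changes. -/
def SkorokhodTendsto {V : Type*} [PseudoMetricSpace V] (f : ℕ → ℝ≥0 → V) (g : ℝ≥0 → V) : Prop :=
  ∃ τ : ℕ → (ℝ≥0 ≃o ℝ≥0),
    TendstoUniformly (fun n s => τ n s) id atTop ∧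
    ∀ T : ℝ≥0, TendstoUniformlyOn (fun n s => f n (τ n s)) g atTop (Iic T)

/-- `q(t) = ∑_{t_i ≤ t} (x(t_{i+1}) - x(t_i)) (x(t_{i+1}) - x(t_i))'`, an `m × m` array. -/
def quadSum {m : ℕ} (P : Finset ℝ≥0) (x : Path m) (t : ℝ≥0) : Fin m → Fin m → ℝ :=
  fun i j => ∑ s ∈ P.filter (fun s => s ≤ t),
    (x (nextPt P s) i - x s i) * (x (nextPt P s) j - x s j)

/-- `G` is the quadratic variation of `x` along `π`. -/
def IsQuadVar {m : ℕ} (π : ℕ → Finset ℝ≥0) (x : Path m) (G : ℝ≥0 → Fin m → Fin m → ℝ) : Prop :=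
  IsCadlag G ∧ SkorokhodTendsto (fun n => quadSum (π n) x) G

/-- `x` has finite quadratic variation along `π`. -/
def HasQuadVar {m : ℕ} (π : ℕ → Finset ℝ≥0) (x : Path m) : Prop :=
  ∃ G, IsQuadVar π x G

open Classical in
/-- The quadratic variation `[x]` of `x` along `π` (zero if there is none). -/
def quadVar {m : ℕ} (π : ℕ → Finset ℝ≥0) (x : Path m) : ℝ≥0 → Fin m → Fin m → ℝ :=
  if h : HasQuadVar π x then h.choose else 0

/-! ## Lebesgue-Stieltjes integrals against functions of locally bounded variation -/

open Classical in
/-- The Lebesgue-Stieltjes measure of a nondecreasing function (zero for other functions). -/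
def monoMeasure (h : ℝ≥0 → ℝ) : Measure ℝ≥0 :=
  if hm : Monotone h then hm.stieltjesFunction.measure else 0

/-- The nondecreasing function `(V + g) / 2`, where `V` is the total variation of `g` from `0`. -/
def posVar (g : ℝ≥0 → ℝ) : ℝ≥0 → ℝ := fun t => (variationOnFromTo g univ 0 t + g t) / 2

/-- The nondecreasing function `(V - g) / 2`, where `V` is the total variation of `g` from `0`. -/
def negVar (g : ℝ≥0 → ℝ) : ℝ≥0 → ℝ := fun t => (variationOnFromTo g univ 0 t - g t) / 2

/-- `∫_{(0,t]} f dg` for `g` of locally bounded variation. -/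
def lsIntegral (f g : ℝ≥0 → ℝ) (t : ℝ≥0) : ℝ :=
  (∫ s in Ioc 0 t, f s ∂(monoMeasure (posVar g))) - ∫ s in Ioc 0 t, f s ∂(monoMeasure (negVar g))

/-- The integral `∫_{(0,t]} f dg` is meaningful. -/
def LSIntegrable (f g : ℝ≥0 → ℝ) (t : ℝ≥0) : Prop :=
  LocallyBoundedVariationOn g univ ∧
  IntegrableOn f (Ioc 0 t) (monoMeasure (posVar g)) ∧
  IntegrableOn f (Ioc 0 t) (monoMeasure (negVar g))

/-! ## Generic sets of paths, domains and functionals -/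

/-- Generic sets of càdlàg paths: stable under piecewise constant approximation along `π` and
under vertical perturbations. -/
structure IsGeneric {m : ℕ} (π : ℕ → Finset ℝ≥0) (Ω : Set (Path m)) : Prop where
  nonempty : Ω.Nonempty
  cadlag : ∀ x ∈ Ω, IsCadlag x
  approx : ∀ x ∈ Ω, ∀ T : ℝ≥0, 0 < T → ∃ N : ℕ, ∀ n ≥ N, stopAt (pcApprox (π n) x) T ∈ Ω
  vertical : ∀ x ∈ Ω, ∀ t : ℝ≥0, ∃ U : Set (Vec m), U ∈ 𝓝 0 ∧ Convex ℝ U ∧ -jump x t ∈ U ∧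
    ∀ e ∈ U, bump x t e ∈ Ω

/-- The domain `Λ = {(t, x_t) | t ≥ 0, x ∈ Ω}`. -/
def Domain {m : ℕ} (Ω : Set (Path m)) : Set (ℝ≥0 × Path m) :=
  {p | ∃ t : ℝ≥0, ∃ x ∈ Ω, p = (t, stopAt x t)}

/-- Functionals `Λ → V`. -/
abbrev Functional {m : ℕ} (Ω : Set (Path m)) (V : Type*) : Type _ := Domain Ω → V

open Classical in
/-- The value `F(t, y)`, for `(t, y) ∈ Λ`. The value `0` outside `Λ` is never relevant: on a generic
set all the pairs at which functionals are evaluated below lie in `Λ`, if need be for large `n` or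
for small perturbations. -/
def ev {m : ℕ} {Ω : Set (Path m)} {V : Type*} [Zero V] (F : Functional Ω V) (t : ℝ≥0)
    (y : Path m) : V :=
  if h : (t, y) ∈ Domain Ω then F ⟨(t, y), h⟩ else 0

/-- `F_-(t, x_t) = F(t, x_{t-})`. -/
def minus {m : ℕ} {Ω : Set (Path m)} {V : Type*} [Zero V] (F : Functional Ω V) : Functional Ω V :=
  fun p => ev F p.1.1 (stopLeft p.1.2 p.1.1)

/-- Strictly causal functionals. -/
def StrictlyCausal {m : ℕ} {Ω : Set (Path m)} {V : Type*} [Zero V] (F : Functional Ω V) : Prop :=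
  F = minus F

section Continuity

variable {m : ℕ} (π : ℕ → Finset ℝ≥0) {Ω : Set (Path m)} {V : Type*} [Zero V] [TopologicalSpace V]

/-- Left-continuous functionals. -/
structure LeftCont (F : Functional Ω V) : Prop where
  a : ∀ x ∈ Ω, ∀ t, Tendsto (fun s => ev F s (stopLeft x s)) (𝓝[≤] t) (𝓝 (ev F t (stopLeft x t)))
  b : ∀ x ∈ Ω, ∀ t, Tendsto (fun s => ev F s (stopAt x s)) (𝓝[<] t) (𝓝 (ev F t (stopLeft x t)))
  c : ∀ x ∈ Ω, ∀ t, ∀ u : ℕ → ℝ≥0, Tendsto u atTop (𝓝 t) → (∀ᶠ n in atTop, u n ≤ prevPt (π n) t) →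
    Tendsto (fun n => ev F (u n) (stopLeft (pcApprox (π n) x) (u n))) atTop
      (𝓝 (ev F t (stopLeft x t)))
  d : ∀ x ∈ Ω, ∀ t, ∀ u : ℕ → ℝ≥0, Tendsto u atTop (𝓝 t) → (∀ᶠ n in atTop, u n < prevPt (π n) t) →
    Tendsto (fun n => ev F (u n) (stopAt (pcApprox (π n) x) (u n))) atTop
      (𝓝 (ev F t (stopLeft x t)))

/-- Right-continuous functionals. -/
structure RightCont (F : Functional Ω V) : Prop where
  a : ∀ x ∈ Ω, ∀ t, Tendsto (fun s => ev F s (stopAt x s)) (𝓝[≥] t) (𝓝 (ev F t (stopAt x t)))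
  b : ∀ x ∈ Ω, ∀ t, Tendsto (fun s => ev F s (stopLeft x s)) (𝓝[>] t) (𝓝 (ev F t (stopAt x t)))
  c : ∀ x ∈ Ω, ∀ t, ∀ u : ℕ → ℝ≥0, Tendsto u atTop (𝓝 t) → (∀ᶠ n in atTop, prevPt (π n) t ≤ u n) →
    Tendsto (fun n => ev F (u n) (stopAt (pcApprox (π n) x) (u n))) atTop (𝓝 (ev F t (stopAt x t)))
  d : ∀ x ∈ Ω, ∀ t, ∀ u : ℕ → ℝ≥0, Tendsto u atTop (𝓝 t) → (∀ᶠ n in atTop, prevPt (π n) t < u n) →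
    Tendsto (fun n => ev F (u n) (stopLeft (pcApprox (π n) x) (u n))) atTop (𝓝 (ev F t (stopAt x t)))

end Continuity

/-- The `π`-topology on `Λ`: the initial topology of the real functionals that are left- and
right-continuous. -/
@[reducible] def piTopology {m : ℕ} (π : ℕ → Finset ℝ≥0) (Ω : Set (Path m)) : TopologicalSpace (Domain Ω) :=
  ⨅ F ∈ {F : Functional Ω ℝ | LeftCont π F ∧ RightCont π F},
    TopologicalSpace.induced F inferInstance

/-- The space `C_π(Λ)` of real functionals that are continuous in the `π`-topology. -/
def Cpi {m : ℕ} (π : ℕ → Finset ℝ≥0) (Ω : Set (Path m)) : Submodule ℝ (Functional Ω ℝ) where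
  carrier := {F | @Continuous _ _ (piTopology π Ω) _ F}
  add_mem' {F G} hF hG := by
    let _ : TopologicalSpace (Domain Ω) := piTopology π Ω
    exact Continuous.add (M := ℝ) hF hG
  zero_mem' := by
    let _ : TopologicalSpace (Domain Ω) := piTopology π Ω
    exact (continuous_const : Continuous (fun _ : Domain Ω => (0 : ℝ)))
  smul_mem' r F hF := by
    let _ : TopologicalSpace (Domain Ω) := piTopology π Ω
    exact Continuous.mul (M := ℝ) continuous_const hF

/-- The pointwise product on `C_π(Λ)`. -/
instance cpiMul {m : ℕ} (π : ℕ → Finset ℝ≥0) (Ω : Set (Path m)) : Mul (Cpi π Ω) where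
  mul F G := ⟨(F : Functional Ω ℝ) * (G : Functional Ω ℝ), by
    let _ : TopologicalSpace (Domain Ω) := piTopology π Ω
    exact Continuous.mul (M := ℝ) F.2 G.2⟩

/-- Locally bounded functionals: along each path, bounded on `[0,T]` uniformly over the piecewise
constant approximations of large index. -/
def LocBounded {m : ℕ} (π : ℕ → Finset ℝ≥0) {Ω : Set (Path m)} {V : Type*} [NormedAddCommGroup V]
    (F : Functional Ω V) : Prop :=
  ∀ x ∈ Ω, ∀ T : ℝ≥0, ∃ n₀ : ℕ, ∃ K : ℝ, ∀ n ≥ n₀, ∀ t ≤ T,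
    ‖ev F t (stopAt (pcApprox (π n) x) t)‖ ≤ K

/-! ## Derivatives and classes of functionals -/

/-- The difference quotient `(F(t+h, y) - F(t, y)) / h` at `p = (t, y)`. -/
def horizQuot {m : ℕ} {Ω : Set (Path m)} (F : Functional Ω ℝ) (p : Domain Ω) (h : ℝ≥0) : ℝ :=
  (ev F (p.1.1 + h) p.1.2 - ev F p.1.1 p.1.2) / (h : ℝ)

/-- Horizontal differentiability. -/
def HorizDifferentiable {m : ℕ} {Ω : Set (Path m)} (F : Functional Ω ℝ) : Prop :=
  ∀ p, ∃ l, Tendsto (horizQuot F p) (𝓝[>] 0) (𝓝 l)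

/-- The horizontal derivative. -/
def horizDeriv {m : ℕ} {Ω : Set (Path m)} (F : Functional Ω ℝ) : Functional Ω ℝ :=
  fun p => limUnder (𝓝[>] 0) (horizQuot F p)

/-- Vertical differentiability. -/
def VertDifferentiable {m : ℕ} {Ω : Set (Path m)} (F : Functional Ω ℝ) : Prop :=
  ∀ p : Domain Ω, DifferentiableAt ℝ (fun e : Vec m => ev F p.1.1 (bump p.1.2 p.1.1 e)) 0

/-- The vertical derivative `∇ₓF`. -/
def vertDeriv {m : ℕ} {Ω : Set (Path m)} (F : Functional Ω ℝ) : Functional Ω (Vec m) :=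
  fun p => gradient (fun e : Vec m => ev F p.1.1 (bump p.1.2 p.1.1 e)) 0

/-- Class `𝒮`. -/
structure ClassS {m : ℕ} (π : ℕ → Finset ℝ≥0) {Ω : Set (Path m)} (F : Functional Ω ℝ) : Prop where
  cont : F ∈ Cpi π Ω
  horiz : HorizDifferentiable F
  vert : VertDifferentiable F
  horiz_right : RightCont π (horizDeriv F)
  horiz_bdd : LocBounded π (horizDeriv F)
  vert_left : LeftCont π (vertDeriv F)
  vert_causal : StrictlyCausal (vertDeriv F)

/-- Class `ℳ`. -/
def ClassM {m : ℕ} (π : ℕ → Finset ℝ≥0) {Ω : Set (Path m)} (F : Functional Ω ℝ) : Prop :=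
  ClassS π F ∧ horizDeriv F = 0

/-- Class `ℳ_b`. -/
def ClassMb {m : ℕ} (π : ℕ → Finset ℝ≥0) {Ω : Set (Path m)} (F : Functional Ω ℝ) : Prop :=
  ClassM π F ∧ LocBounded π (vertDeriv F)

/-- The set `𝔏_b(Λ) = {∇ₓF | F ∈ ℳ_b(Λ)}`. -/
def Lb {m : ℕ} (π : ℕ → Finset ℝ≥0) (Ω : Set (Path m)) : Set (Functional Ω (Vec m)) :=
  {φ | ∃ F : Functional Ω ℝ, ClassMb π F ∧ φ = vertDeriv F}

/-! ## Pathwise integration -/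

/-- The Riemann sum `∑_{t_i ≤ t} φ(t_i, xⁿ_{t_i-}) · (x(t_{i+1}) - x(t_i))`. -/
def riemannSum {m : ℕ} {Ω : Set (Path m)} (P : Finset ℝ≥0) (φ : Functional Ω (Vec m))
    (t : ℝ≥0) (x : Path m) : ℝ :=
  ∑ s ∈ P.filter (fun s => s ≤ t),
    inner ℝ (ev φ s (stopLeft (pcApprox P x) s)) (x (nextPt P s) - x s)

/-- The pathwise integral `∫ φ dx`, as a functional on `Λ`. -/
def pathInt {m : ℕ} (π : ℕ → Finset ℝ≥0) {Ω : Set (Path m)} (φ : Functional Ω (Vec m)) :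
    Functional Ω ℝ :=
  fun p => limUnder atTop (fun n => riemannSum (π n) φ p.1.1 p.1.2)

/-- `Λ`-integrability of `φ`: the Riemann sums converge and the integral is a continuous
functional. -/
structure PathIntegrable {m : ℕ} (π : ℕ → Finset ℝ≥0) {Ω : Set (Path m)}
    (φ : Functional Ω (Vec m)) : Prop where
  left : LeftCont π (minus φ)
  conv : ∀ x ∈ Ω, ∀ t, Tendsto (fun n => riemannSum (π n) φ t x) atTop
    (𝓝 (ev (pathInt π φ) t (stopAt x t)))
  cont : pathInt π φ ∈ Cpi π Ω

/-- The bracket `{φ, ψ} = (ψ ∫φ dx + φ ∫ψ dx)_-`. -/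
def bracket {m : ℕ} (π : ℕ → Finset ℝ≥0) {Ω : Set (Path m)} (φ ψ : Functional Ω (Vec m)) :
    Functional Ω (Vec m) :=
  minus (fun p => pathInt π φ p • ψ p + pathInt π ψ p • φ p)

/-- The functional `∫ φψ' d[x]`, that is
`(t, x) ↦ ∑_{i,j} ∫_{(0,t]} φ_i(s, x_{s-}) ψ_j(s, x_{s-}) d[x]_{ij}(s)`. -/
def qvInt {m : ℕ} (π : ℕ → Finset ℝ≥0) {Ω : Set (Path m)} (φ ψ : Functional Ω (Vec m)) :
    Functional Ω ℝ :=
  fun p => ∑ i, ∑ j, lsIntegral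
    (fun s => ev φ s (stopLeft p.1.2 s) i * ev ψ s (stopLeft p.1.2 s) j)
    (fun s => quadVar π p.1.2 s i j) p.1.1

/-- All the Lebesgue-Stieltjes integrals in `∫ φψ' d[x]` are meaningful. -/
def QVIntegrable {m : ℕ} (π : ℕ → Finset ℝ≥0) {Ω : Set (Path m)} (φ ψ : Functional Ω (Vec m)) :
    Prop :=
  ∀ p : Domain Ω, ∀ i j, LSIntegrable
    (fun s => ev φ s (stopLeft p.1.2 s) i * ev ψ s (stopLeft p.1.2 s) j)
    (fun s => quadVar π p.1.2 s i j) p.1.1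

end PathwiseCalculus

end

noncomputable section

namespace PathwiseCalculus

section

variable {m : ℕ} {π : ℕ → Finset ℝ≥0} {Ω : Set (Path m)}

/-! ## Stopped paths -/

section Stopping

variable {V : Type*} [TopologicalSpace V] {x y : ℝ≥0 → V} {t : ℝ≥0}

/-! The engine is an exact discrete calculus along the approximations `pcApprox (π n) x`. If the
horizontal derivative of F vanishes, F is constant in time along a frozen path
(`ev_eq_ev_of_horizDeriv_eq_zero`), so along an approximation it moves only at partition points. If
the vertical derivative is strictly causal, the gradient of `e ↦ F(t, x_t + e 1_{[t,∞)})` does not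
depend on `e`, so F moves there by exactly the gradient times the jump
(`ev_stopAt_sub_ev_stopLeft`). That jump at `t_i` is `x(t_{i+1}) - x(t_i)`; the Riemann sums of `∇F`
therefore telescope without error, apart from the summand at time zero, which tends to zero
(`riemannSum_eq`). In the limit `∫ ∇F dx = F - F(0, x_0)`. Hence integrals of elements of `𝔏_b` are
of class `ℳ_b`, and the vertical derivative returns the integrand at positive times; its values at
time zero are invisible to the integral.

Telescoping a product of two integrals gives a discrete Leibniz rule (`ev_mul_ev_pathInt`), whose
limit is `∫φ dx ∫ψ dx = ∫{φ,ψ} dx + ∫φψ' d[x]` (`qvInt_eq`). The functional `𝔼` kills the bracket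
term, which is the isometry; what remains is the algebra of semidefinite forms, with positivity
coming from squares.

The analytic work is the limit of the sums of products of increments. Polarization reduces it to
weighted sums of squared increments in one direction, whose distribution functions converge to a
nondecreasing `g` in the J₁ sense. The weights converge only along points lying to the left of the
partition interval, and `g` may jump. But unrestricted convergence fails at countably many points
only (`LeftConv.countable_not_tendsto`), and at a jump of `g` the time change eventually hits the
left endpoint of the partition interval (`eventually_eq_prevPt`), where the weights do converge.
Quantile functions turn the integrals into Lebesgue integrals over levels, countably many levels are
discarded, and dominated convergence applies (`tendsto_integral_of_timeChange`). -/

theorem leftLim_zero (x : ℝ≥0 → V) : Function.leftLim x 0 = x 0 :=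
  leftLim_eq_of_isBot fun _ => zero_le

theorem IsCadlag.tendsto_leftLim (hx : IsCadlag x) (t : ℝ≥0) :
    Tendsto x (𝓝[<] t) (𝓝 (Function.leftLim x t)) :=
  tendsto_leftLim_of_tendsto (hx t).2

theorem nhdsLT_neBot (ht : 0 < t) : (𝓝[<] t).NeBot :=
  nhdsLT_neBot_of_exists_lt ⟨0, ht⟩

theorem leftLim_congr_of_pos [T2Space V] (ht : 0 < t) (hx : IsCadlag x)
    (h : ∀ s < t, x s = y s) : Function.leftLim x t = Function.leftLim y t := by
  have := nhdsLT_neBot ht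
  exact (leftLim_eq_of_tendsto
    ((hx.tendsto_leftLim t).congr' (eventually_nhdsWithin_of_forall h))).symm

/-- Agreement at `t` itself matters only for `t = 0`, where the left limit is the value. -/
theorem leftLim_congr [T2Space V] (hx : IsCadlag x) (h : ∀ s ≤ t, x s = y s) :
    Function.leftLim x t = Function.leftLim y t := by
  rcases eq_zero_or_pos t with rfl | ht
  · rw [leftLim_zero, leftLim_zero, h 0 le_rfl]
  · exact leftLim_congr_of_pos ht hx fun s hs => h s hs.le

theorem leftLim_eq_of_const [T2Space V] {s : ℝ≥0} (hs : s < t) {c : V}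
    (h : ∀ r, s ≤ r → r < t → x r = c) : Function.leftLim x t = c := by
  have := nhdsLT_neBot (zero_le.trans_lt hs)
  refine leftLim_eq_of_tendsto (tendsto_const_nhds.congr' ?_)
  filter_upwards [Ioo_mem_nhdsLT hs] with r hr
  exact (h r hr.1.le hr.2).symm

end Stopping

theorem stopAt_of_le {x : Path m} {s t : ℝ≥0} (h : s ≤ t) : stopAt x t s = x s := by
  simp [stopAt, h]

theorem stopAt_of_ge {x : Path m} {s t : ℝ≥0} (h : t ≤ s) : stopAt x t s = x t := by
  simp [stopAt, h]

theorem stopAt_stopAt (x : Path m) (s t : ℝ≥0) :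
    stopAt (stopAt x s) t = stopAt x (min t s) := by
  funext r; simp [stopAt, min_assoc]

theorem stopAt_stopAt_of_le (x : Path m) {s t : ℝ≥0} (h : t ≤ s) :
    stopAt (stopAt x s) t = stopAt x t := by
  rw [stopAt_stopAt, min_eq_left h]

theorem stopAt_stopAt_of_ge (x : Path m) {s t : ℝ≥0} (h : s ≤ t) :
    stopAt (stopAt x s) t = stopAt x s := by
  rw [stopAt_stopAt, min_eq_right h]

theorem stopAt_stopLeft (x : Path m) {s t : ℝ≥0} (h : t ≤ s) :
    stopAt (stopLeft x t) s = stopLeft x t := by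
  funext r
  rcases le_total r s with hr | hr
  · rw [stopAt_of_le hr]
  · rw [stopAt_of_ge hr, stopLeft, stopLeft, if_neg h.not_gt, if_neg (h.trans hr).not_gt]

theorem stopAt_congr {x y : Path m} {t : ℝ≥0} (h : ∀ s ≤ t, x s = y s) :
    stopAt x t = stopAt y t :=
  funext fun _ => h _ (min_le_right _ _)

theorem stopLeft_congr {x y : Path m} {t : ℝ≥0} (hx : IsCadlag x) (h : ∀ s ≤ t, x s = y s) :
    stopLeft x t = stopLeft y t := by
  funext r
  simp only [stopLeft, leftLim_congr hx h]
  split_ifs with hr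
  exacts [h r hr.le, rfl]

theorem stopLeft_congr_of_pos {x y : Path m} {t : ℝ≥0} (ht : 0 < t) (hx : IsCadlag x)
    (h : ∀ s < t, x s = y s) : stopLeft x t = stopLeft y t := by
  funext r
  simp only [stopLeft, leftLim_congr_of_pos ht hx h]
  split_ifs with hr
  exacts [h r hr, rfl]

theorem stopLeft_zero (x : Path m) : stopLeft x 0 = stopAt x 0 := by
  funext r; simp [stopLeft, stopAt, leftLim_zero]

theorem stopLeft_stopLeft {x : Path m} (hx : IsCadlag x) (t : ℝ≥0) :
    stopLeft (stopLeft x t) t = stopLeft x t := by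
  rcases eq_zero_or_pos t with rfl | ht
  · funext r
    simp [stopLeft, leftLim_zero]
  · exact (stopLeft_congr_of_pos ht hx fun s hs => by rw [stopLeft, if_pos hs]).symm

theorem stopLeft_eq_stopAt_of_const {x : Path m} {s t : ℝ≥0} (hs : s < t)
    (h : ∀ r, s ≤ r → r < t → x r = x s) : stopLeft x t = stopAt x s := by
  funext r
  rw [stopLeft, leftLim_eq_of_const hs h]
  split_ifs with hr
  · rcases le_total r s with h' | h'
    · rw [stopAt_of_le h']
    · rw [stopAt_of_ge h', h r h' hr]
  · rw [stopAt_of_ge (hs.le.trans (not_lt.1 hr))]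

theorem stopAt_eq_stopAt_of_const {x : Path m} {s t : ℝ≥0} (hs : s ≤ t)
    (h : ∀ r, s ≤ r → r ≤ t → x r = x s) : stopAt x t = stopAt x s := by
  funext r
  rcases le_total r s with h' | h'
  · rw [stopAt_of_le h', stopAt_of_le (h'.trans hs)]
  · rw [stopAt_of_ge h', stopAt, h _ (le_min h' hs) (min_le_right _ _)]

theorem bump_zero (x : Path m) (t : ℝ≥0) : bump x t 0 = stopAt x t := by
  funext r; simp [bump]

/-- This is the use of `-jump x t ∈ U` in genericity: it places `x_{t-}` in `Ω` and joins it to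
`x_t` by a segment of admissible bumps. -/
theorem bump_neg_jump (x : Path m) (t : ℝ≥0) : bump x t (-jump x t) = stopLeft x t := by
  funext r
  rcases lt_or_ge r t with h | h
  · simp [bump, stopLeft, stopAt, h, h.le, h.not_ge]
  · simp [bump, stopLeft, stopAt, h, h.not_gt, jump]

theorem bump_of_lt {x : Path m} {s t : ℝ≥0} (e : Vec m) (h : s < t) : bump x t e s = x s := by
  simp [bump, stopAt, h.le, h.not_ge]

theorem bump_of_ge {x : Path m} {s t : ℝ≥0} (e : Vec m) (h : t ≤ s) :
    bump x t e s = x t + e := by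
  simp [bump, stopAt, h]

theorem bump_bump (x : Path m) (t : ℝ≥0) (e e' : Vec m) :
    bump (bump x t e) t e' = bump x t (e + e') := by
  funext r
  rcases lt_or_ge r t with h | h
  · rw [bump_of_lt _ h, bump_of_lt _ h, bump_of_lt _ h]
  · rw [bump_of_ge _ h, bump_of_ge _ h, bump_of_ge _ le_rfl, add_assoc]

theorem stopAt_bump (x : Path m) {s t : ℝ≥0} (h : t ≤ s) (e : Vec m) :
    stopAt (bump x t e) s = bump x t e := by
  funext r
  rcases le_total r s with hr | hr
  · rw [stopAt_of_le hr]
  · rw [stopAt_of_ge hr, bump_of_ge _ h, bump_of_ge _ (h.trans hr)]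

/-- This fails at time zero, where `x(0-) = x(0)` sees the bump; hence the separate treatment of
time zero below. -/
theorem stopLeft_bump {x : Path m} (hx : IsCadlag x) {t : ℝ≥0} (ht : 0 < t) (e : Vec m) :
    stopLeft (bump x t e) t = stopLeft x t :=
  (stopLeft_congr_of_pos ht hx fun _ hs => (bump_of_lt e hs).symm).symm

theorem stopLeft_stopAt {x : Path m} (hx : IsCadlag x) {s t : ℝ≥0} (h : s ≤ t) :
    stopLeft (stopAt x t) s = stopLeft x s :=
  (stopLeft_congr hx fun _ hr => (stopAt_of_le (hr.trans h)).symm).symm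

theorem stopAt_zero_stopLeft (x : Path m) (t : ℝ≥0) : stopAt (stopLeft x t) 0 = stopAt x 0 := by
  refine stopAt_congr fun s hs => ?_
  rcases eq_zero_or_pos t with rfl | ht
  · rw [stopLeft_zero, stopAt_of_le hs]
  · rw [stopLeft, if_pos (hs.trans_lt ht)]

/-! ## The domain -/


theorem IsGeneric.stopAt_mem (hΩ : IsGeneric π Ω) {x : Path m} (hx : x ∈ Ω) (t : ℝ≥0) :
    stopAt x t ∈ Ω := by
  obtain ⟨U, hU, -, -, h⟩ := hΩ.vertical x hx t
  simpa [bump_zero] using h 0 (mem_of_mem_nhds hU)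

theorem IsGeneric.stopLeft_mem (hΩ : IsGeneric π Ω) {x : Path m} (hx : x ∈ Ω) (t : ℝ≥0) :
    stopLeft x t ∈ Ω := by
  obtain ⟨U, -, -, hj, h⟩ := hΩ.vertical x hx t
  simpa [bump_neg_jump] using h _ hj

theorem mem_domain_of_stopAt_eq {x : Path m} (hx : x ∈ Ω) {t : ℝ≥0} (h : stopAt x t = x) :
    (t, x) ∈ Domain Ω :=
  ⟨t, x, hx, by rw [h]⟩

theorem stopAt_mem_domain {x : Path m} (hx : x ∈ Ω) (t : ℝ≥0) : (t, stopAt x t) ∈ Domain Ω :=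
  ⟨t, x, hx, rfl⟩

theorem IsGeneric.stopLeft_mem_domain (hΩ : IsGeneric π Ω) {x : Path m} (hx : x ∈ Ω) (t : ℝ≥0) :
    (t, stopLeft x t) ∈ Domain Ω :=
  mem_domain_of_stopAt_eq (hΩ.stopLeft_mem hx t) (stopAt_stopLeft x le_rfl)

theorem stopAt_eq_of_mem_domain {t : ℝ≥0} {x : Path m} (h : (t, x) ∈ Domain Ω) :
    stopAt x t = x := by
  obtain ⟨s, y, -, he⟩ := h
  rw [Prod.mk.injEq] at he
  obtain ⟨rfl, rfl⟩ := he
  exact stopAt_stopAt_of_le y le_rfl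

theorem IsGeneric.mem_of_mem_domain (hΩ : IsGeneric π Ω) {t : ℝ≥0} {x : Path m}
    (h : (t, x) ∈ Domain Ω) : x ∈ Ω := by
  obtain ⟨s, y, hy, he⟩ := h
  rw [Prod.mk.injEq] at he
  obtain ⟨rfl, rfl⟩ := he
  exact hΩ.stopAt_mem hy _

theorem IsGeneric.eventually_approx_mem (hΩ : IsGeneric π Ω) {x : Path m} (hx : x ∈ Ω)
    (T : ℝ≥0) : ∀ᶠ n in atTop, stopAt (pcApprox (π n) x) T ∈ Ω := by
  -- Genericity speaks of positive horizons only; `T + 1` covers `T = 0`.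
  obtain ⟨N, hN⟩ := hΩ.approx x hx (T + 1) (by positivity)
  filter_upwards [eventually_ge_atTop N] with n hn
  simpa [stopAt_stopAt_of_le _ (le_self_add : T ≤ T + 1)] using hΩ.stopAt_mem (hN n hn) T

section Values

variable {V : Type*}

theorem ev_of_mem [Zero V] (F : Functional Ω V) {t : ℝ≥0} {y : Path m}
    (h : (t, y) ∈ Domain Ω) : ev F t y = F ⟨(t, y), h⟩ := dif_pos h

theorem ev_coe [Zero V] (F : Functional Ω V) (p : Domain Ω) : ev F p.1.1 p.1.2 = F p :=
  dif_pos p.2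

theorem ev_add [AddZeroClass V] (F G : Functional Ω V) (t : ℝ≥0) (y : Path m) :
    ev (F + G) t y = ev F t y + ev G t y := by
  by_cases h : (t, y) ∈ Domain Ω <;> simp [ev, h]

theorem ev_sub [AddGroup V] (F G : Functional Ω V) (t : ℝ≥0) (y : Path m) :
    ev (F - G) t y = ev F t y - ev G t y := by
  by_cases h : (t, y) ∈ Domain Ω <;> simp [ev, h]

theorem ev_smul [Zero V] {R : Type*} [SMulZeroClass R V] (r : R) (F : Functional Ω V) (t : ℝ≥0)
    (y : Path m) : ev (r • F) t y = r • ev F t y := by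
  by_cases h : (t, y) ∈ Domain Ω <;> simp [ev, h]

theorem ev_minus [Zero V] (hΩ : IsGeneric π Ω) (F : Functional Ω V) {x : Path m} (hx : x ∈ Ω)
    (t : ℝ≥0) : ev (minus F) t (stopLeft x t) = ev F t (stopLeft x t) := by
  rw [ev_of_mem _ (hΩ.stopLeft_mem_domain hx t), minus]
  simp only [stopLeft_stopLeft (hΩ.cadlag x hx)]

theorem StrictlyCausal.ev_stopAt [Zero V] {F : Functional Ω V} (hF : StrictlyCausal F)
    (hΩ : IsGeneric π Ω) {x : Path m} (hx : x ∈ Ω) (t : ℝ≥0) :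
    ev F t (stopAt x t) = ev F t (stopLeft x t) := by
  conv_lhs => rw [hF, ev_of_mem _ (stopAt_mem_domain hx t), minus]
  simp only [stopLeft_stopAt (hΩ.cadlag x hx) le_rfl]

end Values

/-! ## Continuity in the `π`-topology -/

/-- In an initial topology a family converges as soon as every generating functional converges along
it. -/
theorem tendsto_ev_of_mem_cpi {F : Functional Ω ℝ} (hF : F ∈ Cpi π Ω) {ι : Type*} {l : Filter ι}
    {u : ι → ℝ≥0} {y : ι → Path m} {t : ℝ≥0} {z : Path m} (hz : (t, z) ∈ Domain Ω)
    (hu : ∀ᶠ i in l, (u i, y i) ∈ Domain Ω)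
    (h : ∀ G : Functional Ω ℝ, LeftCont π G → RightCont π G →
      Tendsto (fun i => ev G (u i) (y i)) l (𝓝 (ev G t z))) :
    Tendsto (fun i => ev F (u i) (y i)) l (𝓝 (ev F t z)) := by
  classical
  -- Indices outside the domain are sent to the limit point; they do not matter along `l`.
  let v : ι → Domain Ω := fun i => if h : (u i, y i) ∈ Domain Ω then ⟨_, h⟩ else ⟨_, hz⟩
  have hv : ∀ G : Functional Ω ℝ, (fun i => ev G (u i) (y i)) =ᶠ[l] G ∘ v := fun G => by
    filter_upwards [hu] with i hi
    simp [ev, v, hi]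
  have hlim : Tendsto v l (@nhds _ (piTopology π Ω) ⟨(t, z), hz⟩) := by
    simp only [nhds_iInf, nhds_induced, tendsto_iInf, tendsto_comap_iff]
    intro G hG
    have := (h G hG.1 hG.2).congr' (hv G)
    rwa [ev_of_mem _ hz] at this
  let _ : TopologicalSpace (Domain Ω) := piTopology π Ω
  have hc : Continuous F := hF
  rw [ev_of_mem _ hz]
  exact ((hc.tendsto _).comp hlim).congr' (hv F).symm

theorem mem_cpi_of_leftCont_of_rightCont {F : Functional Ω ℝ} (hl : LeftCont π F)
    (hr : RightCont π F) : F ∈ Cpi π Ω := by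
  have h : piTopology π Ω ≤ TopologicalSpace.induced F inferInstance :=
    iInf₂_le (f := fun (F : Functional Ω ℝ) (_ : F ∈ {F | LeftCont π F ∧ RightCont π F}) =>
      TopologicalSpace.induced F inferInstance) F ⟨hl, hr⟩
  exact continuous_iff_le_induced.2 h

theorem IsGeneric.eventually_stopAt_mem_domain (hΩ : IsGeneric π Ω) {x : Path m} (hx : x ∈ Ω)
    {t : ℝ≥0} {u : ℕ → ℝ≥0} (hu : Tendsto u atTop (𝓝 t)) :
    ∀ᶠ n in atTop, (u n, stopAt (pcApprox (π n) x) (u n)) ∈ Domain Ω := by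
  filter_upwards [hΩ.eventually_approx_mem hx (t + 1),
    hu.eventually_le_const (lt_add_one t)] with n hn hun
  simpa [stopAt_stopAt_of_le _ hun] using stopAt_mem_domain hn (u n)

theorem stopLeft_stopAt_of_stopAt_mem (hΩ : IsGeneric π Ω) {x : Path m} {s t : ℝ≥0}
    (hx : stopAt x t ∈ Ω) (h : s ≤ t) : stopLeft (stopAt x t) s = stopLeft x s :=
  stopLeft_congr (hΩ.cadlag _ hx) fun _ hr => stopAt_of_le (hr.trans h)

theorem IsGeneric.eventually_stopLeft_mem_domain (hΩ : IsGeneric π Ω) {x : Path m} (hx : x ∈ Ω)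
    {t : ℝ≥0} {u : ℕ → ℝ≥0} (hu : Tendsto u atTop (𝓝 t)) :
    ∀ᶠ n in atTop, (u n, stopLeft (pcApprox (π n) x) (u n)) ∈ Domain Ω := by
  filter_upwards [hΩ.eventually_approx_mem hx (t + 1),
    hu.eventually_le_const (lt_add_one t)] with n hn hun
  simpa [stopLeft_stopAt_of_stopAt_mem hΩ hn hun] using hΩ.stopLeft_mem_domain hn (u n)

/-- Each clause asks for convergence along a particular family in `Λ`, which the generators satisfy
by definition and which passes to all functionals continuous for the `π`-topology. -/
theorem leftCont_of_mem_cpi (hΩ : IsGeneric π Ω) {F : Functional Ω ℝ} (hF : F ∈ Cpi π Ω) :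
    LeftCont π F where
  a x hx t := tendsto_ev_of_mem_cpi hF (hΩ.stopLeft_mem_domain hx t)
    (Eventually.of_forall fun s => hΩ.stopLeft_mem_domain hx s) fun _ hG _ => hG.a x hx t
  b x hx t := tendsto_ev_of_mem_cpi hF (hΩ.stopLeft_mem_domain hx t)
    (Eventually.of_forall fun s => stopAt_mem_domain hx s) fun _ hG _ => hG.b x hx t
  c x hx t u hu h := tendsto_ev_of_mem_cpi hF (hΩ.stopLeft_mem_domain hx t)
    (hΩ.eventually_stopLeft_mem_domain hx hu) fun _ hG _ => hG.c x hx t u hu h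
  d x hx t u hu h := tendsto_ev_of_mem_cpi hF (hΩ.stopLeft_mem_domain hx t)
    (hΩ.eventually_stopAt_mem_domain hx hu) fun _ hG _ => hG.d x hx t u hu h

theorem rightCont_of_mem_cpi (hΩ : IsGeneric π Ω) {F : Functional Ω ℝ} (hF : F ∈ Cpi π Ω) :
    RightCont π F where
  a x hx t := tendsto_ev_of_mem_cpi hF (stopAt_mem_domain hx t)
    (Eventually.of_forall fun s => stopAt_mem_domain hx s) fun _ _ hG => hG.a x hx t
  b x hx t := tendsto_ev_of_mem_cpi hF (stopAt_mem_domain hx t)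
    (Eventually.of_forall fun s => hΩ.stopLeft_mem_domain hx s) fun _ _ hG => hG.b x hx t
  c x hx t u hu h := tendsto_ev_of_mem_cpi hF (stopAt_mem_domain hx t)
    (hΩ.eventually_stopAt_mem_domain hx hu) fun _ _ hG => hG.c x hx t u hu h
  d x hx t u hu h := tendsto_ev_of_mem_cpi hF (stopAt_mem_domain hx t)
    (hΩ.eventually_stopLeft_mem_domain hx hu) fun _ _ hG => hG.d x hx t u hu h

end

section

variable {m : ℕ} {π : ℕ → Finset ℝ≥0} {Ω : Set (Path m)}

/-! ## Increments of functionals with causal derivatives -/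

/-- Strict causality makes the gradient at the bumped path a function of the path before `t`, so it
is the same vector for every admissible `e`. -/
theorem hasGradientAt_bump (hΩ : IsGeneric π Ω) {F : Functional Ω ℝ} (hv : VertDifferentiable F)
    (hs : StrictlyCausal (vertDeriv F)) {x : Path m} (hx : x ∈ Ω) {t : ℝ≥0} (ht : 0 < t)
    {e : Vec m} (he : bump x t e ∈ Ω) :
    HasGradientAt (fun e => ev F t (bump x t e)) (ev (vertDeriv F) t (stopLeft x t)) e := by
  have hm : (t, bump x t e) ∈ Domain Ω := mem_domain_of_stopAt_eq he (stopAt_bump x le_rfl e)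
  have h := (hv ⟨_, hm⟩).hasGradientAt
  have hg : gradient (fun e' : Vec m => ev F t (bump (bump x t e) t e')) 0 =
      ev (vertDeriv F) t (stopLeft x t) := by
    rw [← stopLeft_bump (hΩ.cadlag x hx) ht e, ← hs.ev_stopAt hΩ he, stopAt_bump x le_rfl e,
      ev_of_mem _ hm, vertDeriv]
  simp only [hg] at h
  simp only [bump_bump] at h
  rw [hasGradientAt_iff_hasFDerivAt] at h ⊢
  -- The derivative is known at increment `0`, written `e - e` so that composing with `y ↦ y - e`
  -- moves it to `e`.
  have h' : HasFDerivAt (fun e' : Vec m => ev F t (bump x t (e + e')))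
      (InnerProductSpace.toDual ℝ (Vec m) (ev (vertDeriv F) t (stopLeft x t))) (e - e) := by
    rwa [sub_self]
  have h2 := HasFDerivAt.comp (f := fun y => y - e) e h' ((hasFDerivAt_id e).sub_const e)
  simpa [Function.comp_def] using h2

/-- Mean value theorem on the segment of bumps `-r Δx(t)`, `0 ≤ r ≤ 1`, from `x_t` to `x_{t-}`: it
stays in the convex set `U`, and the gradient is constant along it. -/
theorem ev_stopAt_sub_ev_stopLeft (hΩ : IsGeneric π Ω) {F : Functional Ω ℝ}
    (hv : VertDifferentiable F) (hs : StrictlyCausal (vertDeriv F)) {x : Path m} (hx : x ∈ Ω)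
    {t : ℝ≥0} (ht : 0 < t) :
    ev F t (stopAt x t) - ev F t (stopLeft x t) =
      inner ℝ (ev (vertDeriv F) t (stopLeft x t)) (jump x t) := by
  obtain ⟨U, hU, hc, hj, h⟩ := hΩ.vertical x hx t
  set c := ev (vertDeriv F) t (stopLeft x t) with hcdef
  set J := jump x t with hJ
  have hd : ∀ r ∈ Icc (0 : ℝ) 1,
      HasDerivAt (fun r : ℝ => ev F t (bump x t (r • -J))) (inner ℝ c (-J)) r := by
    intro r hr
    have hmem : r • -J ∈ U := hc.smul_mem_of_zero_mem (mem_of_mem_nhds hU) hj hr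
    have h1 := (hasGradientAt_bump hΩ hv hs hx ht (h _ hmem)).hasFDerivAt
    have h2 : HasDerivAt (fun r : ℝ => r • -J) (-J) r := by
      simpa using (hasDerivAt_id r).smul_const (-J)
    simpa [Function.comp_def] using h1.comp_hasDerivAt r h2
  obtain ⟨r, -, hr⟩ := exists_hasDerivAt_eq_slope (fun r : ℝ => ev F t (bump x t (r • -J)))
    (fun _ => inner ℝ c (-J)) zero_lt_one
    (fun r hr => (hd r hr).continuousAt.continuousWithinAt)
    (fun r hr => hd r (Ioo_subset_Icc_self hr))
  simp only [one_smul, zero_smul, bump_zero, inner_neg_right, sub_zero, div_one, hJ,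
    bump_neg_jump] at hr
  linarith

/-- Along a path frozen at `s`, the map `r ↦ F(r, y)` is continuous on `[s,∞)` with zero right
derivative, hence constant. -/
theorem ev_eq_ev_of_horizDeriv_eq_zero (hΩ : IsGeneric π Ω) {F : Functional Ω ℝ}
    (hF : F ∈ Cpi π Ω) (hd : HorizDifferentiable F) (h0 : horizDeriv F = 0) {y : Path m}
    (hy : y ∈ Ω) {s t : ℝ≥0} (hst : s ≤ t) (hys : stopAt y s = y) : ev F t y = ev F s y := by
  have hAt : ∀ {r}, s ≤ r → stopAt y r = y := fun {r} hr => by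
    conv_lhs => rw [← hys]
    rw [stopAt_stopAt_of_ge _ hr, hys]
  have hLeft : ∀ {r}, s < r → stopLeft y r = y := fun {r} hr => by
    rw [stopLeft_eq_stopAt_of_const hr, hys]
    intro q hq _
    rw [← hys, stopAt_of_ge hq, stopAt_of_le le_rfl]
  have hright : ∀ r, s ≤ r → Tendsto (fun q => ev F q y) (𝓝[≥] r) (𝓝 (ev F r y)) := by
    intro r hr
    have h := (rightCont_of_mem_cpi hΩ hF).a y hy r
    rw [hAt hr] at h
    refine h.congr' ?_
    filter_upwards [self_mem_nhdsWithin] with q hq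
    rw [hAt (hr.trans hq)]
  have hcont : ∀ r, s ≤ r → ContinuousWithinAt (fun q => ev F q y) (Ici s) r := by
    intro r hr
    rcases hr.eq_or_lt with rfl | hr'
    · exact hright _ le_rfl
    · refine ContinuousAt.continuousWithinAt ?_
      rw [continuousAt_iff_continuous_left'_right']
      refine ⟨?_, (hright r hr).mono_left (nhdsWithin_mono _ Ioi_subset_Ici_self)⟩
      -- Left continuity yields the limit `F(r, y_{r-})`, and `y_{r-} = y` strictly after the
      -- freezing time.
      have h := (leftCont_of_mem_cpi hΩ hF).b y hy r
      rw [hLeft hr'] at h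
      refine h.congr' ?_
      filter_upwards [Ioo_mem_nhdsLT hr'] with q hq
      rw [hAt hq.1.le]
  have hle : (s : ℝ) ≤ t := hst
  have key := constant_of_has_deriv_right_zero (f := fun r : ℝ => ev F r.toNNReal y)
    (a := s) (b := t) ?_ ?_ t (right_mem_Icc.2 hle)
  · simpa using key
  · intro r hr
    have hr' : s ≤ r.toNNReal := NNReal.le_toNNReal_of_coe_le hr.1
    exact (hcont _ hr').comp continuous_real_toNNReal.continuousWithinAt
      fun q hq => NNReal.le_toNNReal_of_coe_le hq.1
  · intro r hr
    lift r to ℝ≥0 using s.coe_nonneg.trans hr.1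
    have hr' : s ≤ r := by exact_mod_cast hr.1
    have hm : (r, y) ∈ Domain Ω := mem_domain_of_stopAt_eq hy (hAt hr')
    obtain ⟨l, hl⟩ := hd ⟨_, hm⟩
    have hl0 : l = 0 := by
      rw [← hl.limUnder_eq]
      exact congrFun h0 ⟨_, hm⟩
    subst hl0
    rw [hasDerivWithinAt_iff_tendsto_slope, Ici_sdiff_left]
    have hsub : Tendsto (fun q : ℝ => (q - r).toNNReal) (𝓝[>] (r : ℝ)) (𝓝[>] 0) := by
      refine tendsto_nhdsWithin_iff.2 ⟨?_, ?_⟩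
      · have : Continuous fun q : ℝ => (q - r).toNNReal := by fun_prop
        simpa using (this.tendsto (r : ℝ)).mono_left nhdsWithin_le_nhds
      · filter_upwards [self_mem_nhdsWithin] with q hq
        simpa using hq
    refine (hl.comp hsub).congr' ?_
    filter_upwards [self_mem_nhdsWithin] with q hq
    have hq' : (r : ℝ) < q := hq
    have he : r + (q - r).toNNReal = q.toNNReal := by
      rw [← NNReal.coe_inj, NNReal.coe_add, Real.coe_toNNReal _ (sub_nonneg.2 hq'.le),
        Real.coe_toNNReal _ (r.coe_nonneg.trans hq'.le)]
      ring
    simp only [Function.comp, horizQuot, he, slope_def_field, Real.toNNReal_coe,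
      Real.coe_toNNReal _ (sub_nonneg.2 hq'.le)]

end

section

variable {m : ℕ} {π : ℕ → Finset ℝ≥0} {Ω : Set (Path m)}

/-! ## Partitions -/

section Partition

variable {P : Finset ℝ≥0} {s t : ℝ≥0}

theorem lt_lastPt_iff : t < lastPt P ↔ ∃ s ∈ P, t < s := by
  simp [lastPt, Finset.lt_sup_iff]

theorem le_lastPt (hs : s ∈ P) : s ≤ lastPt P := Finset.le_sup (f := id) hs

theorem nextPt_of_lt (h : t < lastPt P) :
    nextPt P t ∈ P ∧ t < nextPt P t ∧ ∀ s ∈ P, t < s → nextPt P t ≤ s := by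
  obtain ⟨s, hs, hts⟩ := lt_lastPt_iff.1 h
  have hne : (P.filter (fun s => t < s)).Nonempty := ⟨s, by simp [hs, hts]⟩
  have hmem := Finset.min'_mem _ hne
  rw [nextPt, dif_pos hne]
  rw [Finset.mem_filter] at hmem
  exact ⟨hmem.1, hmem.2, fun r hr htr => Finset.min'_le _ _ (by simp [hr, htr])⟩

theorem le_nextPt (hs : s ∈ P) : s ≤ nextPt P s := by
  by_cases h : s < lastPt P
  · exact (nextPt_of_lt h).2.1.le
  · rw [nextPt, dif_neg]
    · exact le_lastPt hs
    · rintro ⟨r, hr⟩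
      rw [Finset.mem_filter] at hr
      exact h (lt_lastPt_iff.2 ⟨r, hr⟩)

theorem prevPt_zero (P : Finset ℝ≥0) : prevPt P 0 = 0 := by
  simp [prevPt]

theorem prevPt_of_pos (h0 : 0 ∈ P) (ht : 0 < t) :
    prevPt P t ∈ P ∧ prevPt P t < t ∧ ∀ s ∈ P, s < t → s ≤ prevPt P t := by
  have hne : (P.filter (fun s => s < t)).Nonempty := ⟨0, by simp [h0, ht]⟩
  obtain ⟨r, hr, he⟩ := Finset.exists_mem_eq_sup _ hne id
  rw [Finset.mem_filter] at hr
  rw [prevPt, he]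
  refine ⟨hr.1, hr.2, fun s hs hst => ?_⟩
  rw [← he]
  exact Finset.le_sup (f := id) (by simp [hs, hst])

theorem prevPt_le (h0 : 0 ∈ P) : prevPt P t ≤ t := by
  rcases eq_zero_or_pos t with rfl | ht
  · rw [prevPt_zero]
  · exact (prevPt_of_pos h0 ht).2.1.le

theorem prevPt_eq (h0 : 0 ∈ P) (hs : s ∈ P) (hst : s < t) (h : t ≤ nextPt P s) :
    prevPt P t = s := by
  obtain ⟨h1, h2, h3⟩ := prevPt_of_pos h0 (zero_le.trans_lt hst)
  refine le_antisymm (not_lt.1 fun hlt => ?_) (h3 s hs hst)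
  have := (nextPt_of_lt (lt_lastPt_iff.2 ⟨_, h1, hlt⟩)).2.2 _ h1 hlt
  exact (this.trans_lt h2).not_ge h

theorem nextPt_prevPt (h0 : 0 ∈ P) (hs : s ∈ P) (hpos : 0 < s) : nextPt P (prevPt P s) = s := by
  obtain ⟨-, h2, h3⟩ := prevPt_of_pos h0 hpos
  obtain ⟨g1, g2, g3⟩ := nextPt_of_lt (lt_lastPt_iff.2 ⟨s, hs, h2⟩)
  refine le_antisymm (g3 s hs h2) (not_lt.1 fun hlt => ?_)
  exact (h3 _ g1 hlt).not_gt g2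

theorem pcApprox_of_lt (x : Path m) (ht : t < lastPt P) : pcApprox P x t = x (nextPt P t) :=
  if_pos ht

theorem pcApprox_congr (x : Path m) (hst : s ≤ t) (h : ∀ q ∈ P, s < q → t < q) :
    pcApprox P x t = pcApprox P x s := by
  have hf : P.filter (fun q => t < q) = P.filter (fun q => s < q) :=
    Finset.filter_congr fun q hq => ⟨fun h' => hst.trans_lt h', h q hq⟩
  have hl : t < lastPt P ↔ s < lastPt P := by
    simp only [lt_lastPt_iff]
    exact exists_congr fun q => and_congr_right fun hq => ⟨fun h' => hst.trans_lt h', h q hq⟩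
  simp only [pcApprox, nextPt, hf, hl]

theorem pcApprox_const_prevPt (h0 : 0 ∈ P) (x : Path m) (hpos : 0 < s) :
    ∀ r, prevPt P s ≤ r → r < s → pcApprox P x r = pcApprox P x (prevPt P s) := by
  intro r hr hrs
  refine pcApprox_congr x hr fun q hq hlt => hrs.trans_le (not_lt.1 fun hqs => ?_)
  exact ((prevPt_of_pos h0 hpos).2.2 q hq hqs).not_gt hlt

/-- The approximation looks one point ahead: it equals `x(s)` just before `s` and `x(nextPt P s)`
from `s` on. There is no jump at time zero, which is why the first summand of the Riemann sums stays
apart. -/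
theorem jump_pcApprox (h0 : 0 ∈ P) (x : Path m) (hs : s ∈ P) (hpos : 0 < s)
    (hlast : s < lastPt P) : jump (pcApprox P x) s = x (nextPt P s) - x s := by
  have h2 := (prevPt_of_pos h0 hpos).2.1
  rw [jump, leftLim_eq_of_const h2 (pcApprox_const_prevPt h0 x hpos), pcApprox_of_lt x hlast,
    pcApprox_of_lt x (h2.trans hlast), nextPt_prevPt h0 hs hpos]

/-- Telescoping, by strong induction on the number of partition points up to `t`: move `t` back to
the last of them, then step to its predecessor. -/
theorem sub_eq_sum_of_step (h0 : 0 ∈ P) {Φ c : ℝ≥0 → ℝ} {T : ℝ≥0}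
    (hstep : ∀ s ∈ P, 0 < s → s ≤ T → Φ s - Φ (prevPt P s) = c s)
    (hconst : ∀ s ∈ P, ∀ t ≤ T, s ≤ t → (∀ q ∈ P, s < q → t < q) → Φ t = Φ s) (ht : t ≤ T) :
    Φ t - Φ 0 = ∑ s ∈ P.filter (fun s => 0 < s ∧ s ≤ t), c s := by
  induction hk : (P.filter (fun s => s ≤ t)).card using Nat.strong_induction_on
    generalizing t with
  | _ k ih =>
  have hne : (P.filter (fun s => s ≤ t)).Nonempty := ⟨0, by simp [h0]⟩
  obtain ⟨s, hs, hmax⟩ := Finset.exists_max_image _ id hne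
  simp only [Finset.mem_filter, id] at hs hmax
  have hlt : ∀ q ∈ P, s < q → t < q := fun q hq hsq =>
    not_le.1 fun hqt => (hmax q ⟨hq, hqt⟩).not_gt hsq
  rw [hconst s hs.1 t ht hs.2 hlt]
  rcases eq_zero_or_pos s with rfl | hpos
  · rw [sub_self, Finset.filter_false_of_mem, Finset.sum_empty]
    rintro q hq ⟨hq0, hqt⟩
    exact (hlt q hq hq0).not_ge hqt
  · obtain ⟨p1, p2, p3⟩ := prevPt_of_pos h0 hpos
    have hcard : (P.filter (fun q => q ≤ prevPt P s)).card < k := by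
      rw [← hk]
      refine Finset.card_lt_card ⟨fun q hq => ?_, fun hsub => ?_⟩
      · rw [Finset.mem_filter] at hq ⊢
        exact ⟨hq.1, hq.2.trans (p2.le.trans hs.2)⟩
      · have := hsub (Finset.mem_filter.2 hs)
        rw [Finset.mem_filter] at this
        exact this.2.not_gt p2
    have hih := ih _ hcard (p2.le.trans (hs.2.trans ht)) rfl
    have hset : P.filter (fun q => 0 < q ∧ q ≤ t) =
        insert s (P.filter (fun q => 0 < q ∧ q ≤ prevPt P s)) := by
      ext q
      simp only [Finset.mem_filter, Finset.mem_insert]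
      constructor
      · rintro ⟨hq, hq0, hqt⟩
        rcases (hmax q ⟨hq, hqt⟩).eq_or_lt with rfl | hlt
        · exact Or.inl rfl
        · exact Or.inr ⟨hq, hq0, p3 q hq hlt⟩
      · rintro (rfl | ⟨hq, hq0, hqp⟩)
        · exact ⟨hs.1, hpos, hs.2⟩
        · exact ⟨hq, hq0, hqp.trans (p2.le.trans hs.2)⟩
    rw [hset, Finset.sum_insert (by simp [p2]), ← hih, ← hstep s hs.1 hpos (hs.2.trans ht)]
    ring

theorem sum_filter_le_eq_add (h0 : 0 ∈ P) (c : ℝ≥0 → ℝ) (t : ℝ≥0) :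
    ∑ s ∈ P.filter (fun s => s ≤ t), c s =
      c 0 + ∑ s ∈ P.filter (fun s => 0 < s ∧ s ≤ t), c s := by
  rw [← Finset.sum_insert (by simp)]
  congr 1
  ext q
  simp only [Finset.mem_filter, Finset.mem_insert]
  constructor
  · rintro ⟨hq, hqt⟩
    rcases eq_zero_or_pos q with rfl | hq0
    exacts [Or.inl rfl, Or.inr ⟨hq, hq0, hqt⟩]
  · rintro (rfl | ⟨hq, -, hqt⟩)
    exacts [⟨h0, zero_le⟩, ⟨hq, hqt⟩]

end Partition

theorem IsPartitionSeq.eventually_lt_lastPt (hπ : IsPartitionSeq π) (T : ℝ≥0) :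
    ∀ᶠ n in atTop, T < lastPt (π n) :=
  hπ.last_tendsto.eventually_gt_atTop T

theorem IsPartitionSeq.tendsto_nextPt (hπ : IsPartitionSeq π) {u : ℕ → ℝ≥0} {t : ℝ≥0}
    (hu : Tendsto u atTop (𝓝 t)) (hm : ∀ᶠ n in atTop, u n ∈ π n) :
    Tendsto (fun n => nextPt (π n) (u n)) atTop (𝓝 t) := by
  have h : Tendsto (fun n => (nextPt (π n) (u n) : ℝ) - u n) atTop (𝓝 0) := by
    rw [Metric.tendsto_atTop']
    intro ε hε
    have := (hπ.mesh (t + 1) ε hε).and (hm.and (hu.eventually_le_const (lt_add_one t)))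
    obtain ⟨N, hN⟩ := eventually_atTop.1 this
    refine ⟨N, fun n hn => ?_⟩
    obtain ⟨h1, h2, h3⟩ := hN n hn.le
    have h4 : (u n : ℝ) ≤ nextPt (π n) (u n) := NNReal.coe_le_coe.2 (le_nextPt h2)
    rw [Real.dist_eq, sub_zero, abs_of_nonneg (sub_nonneg.2 h4)]
    exact h1 _ h2 h3
  rw [← NNReal.tendsto_coe] at hu ⊢
  simpa using h.add hu

theorem IsPartitionSeq.tendsto_prevPt (hπ : IsPartitionSeq π) (t : ℝ≥0) :
    Tendsto (fun n => prevPt (π n) t) atTop (𝓝 t) := by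
  rcases eq_zero_or_pos t with rfl | ht
  · simp [prevPt_zero]
  rw [Metric.tendsto_atTop']
  intro ε hε
  obtain ⟨N, hN⟩ := eventually_atTop.1 ((hπ.mesh t ε hε).and (hπ.eventually_lt_lastPt t))
  refine ⟨N, fun n hn => ?_⟩
  obtain ⟨h1, h2⟩ := hN n hn.le
  obtain ⟨p1, p2, p3⟩ := prevPt_of_pos (hπ.zero_mem n) ht
  have hnext : t ≤ nextPt (π n) (prevPt (π n) t) := by
    obtain ⟨g1, g2, -⟩ := nextPt_of_lt (p2.trans h2)
    exact not_lt.1 fun hlt => (p3 _ g1 hlt).not_gt g2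
  have h3 := h1 _ p1 p2.le
  have h4 : (t : ℝ) ≤ nextPt (π n) (prevPt (π n) t) := NNReal.coe_le_coe.2 hnext
  have h5 : (prevPt (π n) t : ℝ) < t := NNReal.coe_lt_coe.2 p2
  rw [NNReal.dist_eq, abs_sub_lt_iff]
  constructor <;> linarith

theorem tendsto_increment_zero (hπ : IsPartitionSeq π) {x : Path m} (hx : IsCadlag x) :
    Tendsto (fun n => x (nextPt (π n) 0) - x 0) atTop (𝓝 0) := by
  have h := hπ.tendsto_nextPt (u := fun _ => 0) tendsto_const_nhds
    (Eventually.of_forall hπ.zero_mem)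
  have h2 : Tendsto x (𝓝 0) (𝓝 (x 0)) := by
    have := (hx 0).1
    rwa [ContinuousWithinAt, show Ici (0 : ℝ≥0) = univ from Ici_bot, nhdsWithin_univ] at this
  simpa using (h2.comp h).sub_const (x 0)

/-! ## Change of variable for functionals of class `ℳ` -/

section ChangeOfVariable

variable (hΩ : IsGeneric π Ω) {F : Functional Ω ℝ} (hF : ClassM π F) {P : Finset ℝ≥0}
  (h0 : 0 ∈ P) {x : Path m} {T : ℝ≥0} (hT : T < lastPt P) (hx : stopAt (pcApprox P x) T ∈ Ω)
include hΩ hF h0 hx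

/-- The approximation is frozen on `[prevPt P s, s)`, and F does not change in time along a frozen
path. -/
theorem ev_stopLeft_pcApprox {s : ℝ≥0} (hpos : 0 < s) (hsT : s ≤ T) :
    ev F s (stopLeft (pcApprox P x) s) =
      ev F (prevPt P s) (stopAt (pcApprox P x) (prevPt P s)) := by
  have h2 := (prevPt_of_pos h0 hpos).2.1
  rw [stopLeft_eq_stopAt_of_const h2 (pcApprox_const_prevPt h0 x hpos)]
  have hy := hΩ.stopAt_mem hx (prevPt P s)
  rw [stopAt_stopAt_of_le _ (h2.le.trans hsT)] at hy
  exact ev_eq_ev_of_horizDeriv_eq_zero hΩ hF.1.cont hF.1.horiz hF.2 hy h2.le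
    (stopAt_stopAt_of_le _ le_rfl)

omit h0 in
theorem ev_stopAt_pcApprox_congr {s t : ℝ≥0} (hst : s ≤ t) (htT : t ≤ T)
    (h : ∀ q ∈ P, s < q → t < q) :
    ev F t (stopAt (pcApprox P x) t) = ev F s (stopAt (pcApprox P x) s) := by
  rw [stopAt_eq_stopAt_of_const hst fun r hr hrt =>
    pcApprox_congr x hr fun q hq hlt => hrt.trans_lt (h q hq hlt)]
  have hy := hΩ.stopAt_mem hx s
  rw [stopAt_stopAt_of_le _ (hst.trans htT)] at hy
  exact ev_eq_ev_of_horizDeriv_eq_zero hΩ hF.1.cont hF.1.horiz hF.2 hy hst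
    (stopAt_stopAt_of_le _ le_rfl)

include hT

theorem ev_stopAt_pcApprox_eq_add {s : ℝ≥0} (hs : s ∈ P) (hpos : 0 < s) (hsT : s ≤ T) :
    ev F s (stopAt (pcApprox P x) s) = ev F s (stopLeft (pcApprox P x) s) +
      inner ℝ (ev (vertDeriv F) s (stopLeft (pcApprox P x) s)) (x (nextPt P s) - x s) := by
  have h := ev_stopAt_sub_ev_stopLeft hΩ hF.1.vert hF.1.vert_causal hx hpos
  have hj : jump (stopAt (pcApprox P x) T) s = x (nextPt P s) - x s := by
    rw [← jump_pcApprox h0 x hs hpos (hsT.trans_lt hT), jump, jump, stopAt_of_le hsT,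
      leftLim_congr (hΩ.cadlag _ hx) fun _ hr => stopAt_of_le (hr.trans hsT)]
  rw [stopAt_stopAt_of_le _ hsT, stopLeft_stopAt_of_stopAt_mem hΩ hx hsT, hj] at h
  linarith

/-- An exact change of variable formula on the approximation. The summand at time zero is kept
separate because the approximation has no jump there. -/
theorem riemannSum_eq {t : ℝ≥0} (ht : t ≤ T) :
    riemannSum P (vertDeriv F) t x =
      inner ℝ (ev (vertDeriv F) 0 (stopLeft (pcApprox P x) 0)) (x (nextPt P 0) - x 0) +
      (ev F t (stopAt (pcApprox P x) t) - ev F 0 (stopAt (pcApprox P x) 0)) := by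
  rw [riemannSum, sum_filter_le_eq_add h0]
  congr 1
  refine (sub_eq_sum_of_step h0 (Φ := fun t => ev F t (stopAt (pcApprox P x) t)) ?_ ?_ ht).symm
  · intro s hs hpos hsT
    rw [ev_stopAt_pcApprox_eq_add hΩ hF h0 hT hx hs hpos hsT,
      ev_stopLeft_pcApprox hΩ hF h0 hx hpos hsT]
    ring
  · intro s _ t htT hst h
    exact ev_stopAt_pcApprox_congr hΩ hF hx hst htT h

end ChangeOfVariable

/-- The integrand at time zero converges, while the first increment vanishes by right-continuity of
`x` at zero. -/
theorem tendsto_initial_term (hπ : IsPartitionSeq π) (hΩ : IsGeneric π Ω)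
    {φ : Functional Ω (Vec m)} (hφ : LeftCont π φ) {x : Path m} (hx : x ∈ Ω) :
    Tendsto (fun n => inner ℝ (ev φ 0 (stopLeft (pcApprox (π n) x) 0))
      (x (nextPt (π n) 0) - x 0)) atTop (𝓝 0) := by
  have h1 := hφ.c x hx 0 (fun _ => 0) tendsto_const_nhds (by simp)
  simpa using h1.inner (𝕜 := ℝ) (tendsto_increment_zero hπ (hΩ.cadlag x hx))

theorem tendsto_ev_stopAt_pcApprox (hπ : IsPartitionSeq π) (hΩ : IsGeneric π Ω)
    {F : Functional Ω ℝ} (hF : F ∈ Cpi π Ω) {x : Path m} (hx : x ∈ Ω) (t : ℝ≥0) :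
    Tendsto (fun n => ev F t (stopAt (pcApprox (π n) x) t)) atTop (𝓝 (ev F t (stopAt x t))) :=
  (rightCont_of_mem_cpi hΩ hF).c x hx t (fun _ => t) tendsto_const_nhds
    (Eventually.of_forall fun n => prevPt_le (hπ.zero_mem n))

theorem tendsto_riemannSum (hπ : IsPartitionSeq π) (hΩ : IsGeneric π Ω) {F : Functional Ω ℝ}
    (hF : ClassM π F) {x : Path m} (hx : x ∈ Ω) (t : ℝ≥0) :
    Tendsto (fun n => riemannSum (π n) (vertDeriv F) t x) atTop
      (𝓝 (ev F t (stopAt x t) - ev F 0 (stopAt x 0))) := by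
  have h := (tendsto_initial_term hπ hΩ hF.1.vert_left hx).add
    ((tendsto_ev_stopAt_pcApprox hπ hΩ hF.1.cont hx t).sub
      (tendsto_ev_stopAt_pcApprox hπ hΩ hF.1.cont hx 0))
  rw [zero_add] at h
  refine h.congr' ?_
  filter_upwards [hΩ.eventually_approx_mem hx t, hπ.eventually_lt_lastPt t] with n hn hT
  exact (riemannSum_eq hΩ hF (hπ.zero_mem n) hT hn le_rfl).symm

/-! ## The integral operator on `𝔏_b` -/

/-- The functional `(t, x_t) ↦ F(0, x_0)`. -/
def initialValue (F : Functional Ω ℝ) : Functional Ω ℝ :=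
  fun p => ev F 0 (stopAt p.1.2 0)

theorem ev_initialValue (F : Functional Ω ℝ) {t : ℝ≥0} {y : Path m} (h : (t, y) ∈ Domain Ω) :
    ev (initialValue F) t y = ev F 0 (stopAt y 0) :=
  ev_of_mem _ h

/-- The functional is constant along each path, so all eight clauses reduce to `F(0, xⁿ_0) → F(0,
x_0)`. -/
theorem initialValue_mem_cpi (hπ : IsPartitionSeq π) (hΩ : IsGeneric π Ω) {F : Functional Ω ℝ}
    (hF : F ∈ Cpi π Ω) : initialValue F ∈ Cpi π Ω := by
  have hA : ∀ {x : Path m}, x ∈ Ω → ∀ t,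
      ev (initialValue F) t (stopAt x t) = ev F 0 (stopAt x 0) := fun hx t => by
    rw [ev_initialValue F (stopAt_mem_domain hx t), stopAt_stopAt_of_le _ zero_le]
  have hL : ∀ {x : Path m}, x ∈ Ω → ∀ t,
      ev (initialValue F) t (stopLeft x t) = ev F 0 (stopAt x 0) := fun hx t => by
    rw [ev_initialValue F (hΩ.stopLeft_mem_domain hx t), stopAt_zero_stopLeft]
  have hpA : ∀ {x : Path m}, x ∈ Ω → ∀ {t} {u : ℕ → ℝ≥0}, Tendsto u atTop (𝓝 t) →
      Tendsto (fun n => ev (initialValue F) (u n) (stopAt (pcApprox (π n) x) (u n))) atTop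
        (𝓝 (ev F 0 (stopAt x 0))) := fun hx t u hu => by
    refine (tendsto_ev_stopAt_pcApprox hπ hΩ hF hx 0).congr' ?_
    filter_upwards [hΩ.eventually_stopAt_mem_domain hx hu] with n hn
    rw [ev_initialValue F hn, stopAt_stopAt_of_le _ zero_le]
  have hpL : ∀ {x : Path m}, x ∈ Ω → ∀ {t} {u : ℕ → ℝ≥0}, Tendsto u atTop (𝓝 t) →
      Tendsto (fun n => ev (initialValue F) (u n) (stopLeft (pcApprox (π n) x) (u n))) atTop
        (𝓝 (ev F 0 (stopAt x 0))) := fun hx t u hu => by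
    refine (tendsto_ev_stopAt_pcApprox hπ hΩ hF hx 0).congr' ?_
    filter_upwards [hΩ.eventually_stopLeft_mem_domain hx hu] with n hn
    rw [ev_initialValue F hn, stopAt_zero_stopLeft]
  refine mem_cpi_of_leftCont_of_rightCont ⟨?_, ?_, ?_, ?_⟩ ⟨?_, ?_, ?_, ?_⟩
  · intro x hx t; simp only [hL hx]; exact tendsto_const_nhds
  · intro x hx t; simp only [hL hx, hA hx]; exact tendsto_const_nhds
  · intro x hx t u hu _; rw [hL hx]; exact hpL hx hu
  · intro x hx t u hu _; rw [hL hx]; exact hpA hx hu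
  · intro x hx t; simp only [hA hx]; exact tendsto_const_nhds
  · intro x hx t; simp only [hL hx, hA hx]; exact tendsto_const_nhds
  · intro x hx t u hu _; rw [hA hx]; exact hpA hx hu
  · intro x hx t u hu _; rw [hA hx]; exact hpL hx hu

theorem pathInt_vertDeriv (hπ : IsPartitionSeq π) (hΩ : IsGeneric π Ω) {F : Functional Ω ℝ}
    (hF : ClassM π F) : pathInt π (vertDeriv F) = F - initialValue F := by
  funext p
  have hp := stopAt_eq_of_mem_domain p.2
  have h := tendsto_riemannSum hπ hΩ hF (hΩ.mem_of_mem_domain p.2) p.1.1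
  rw [pathInt, h.limUnder_eq, hp, ev_coe]
  rfl

theorem ev_pathInt_vertDeriv (hπ : IsPartitionSeq π) (hΩ : IsGeneric π Ω) {F : Functional Ω ℝ}
    (hF : ClassM π F) {t : ℝ≥0} {y : Path m} (h : (t, y) ∈ Domain Ω) :
    ev (pathInt π (vertDeriv F)) t y = ev F t y - ev F 0 (stopAt y 0) := by
  rw [pathInt_vertDeriv hπ hΩ hF, ev_sub, ev_initialValue F h]

theorem pathIntegrable_vertDeriv (hπ : IsPartitionSeq π) (hΩ : IsGeneric π Ω)
    {F : Functional Ω ℝ} (hF : ClassM π F) : PathIntegrable π (vertDeriv F) where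
  left := by
    have h := hF.1.vert_causal
    rw [StrictlyCausal] at h
    exact h ▸ hF.1.vert_left
  conv x hx t := by
    rw [ev_pathInt_vertDeriv hπ hΩ hF (stopAt_mem_domain hx t), stopAt_stopAt_of_le _ zero_le]
    exact tendsto_riemannSum hπ hΩ hF hx t
  cont := by
    rw [pathInt_vertDeriv hπ hΩ hF]
    exact sub_mem hF.1.cont (initialValue_mem_cpi hπ hΩ hF.1.cont)

end

section

variable {m : ℕ} {π : ℕ → Finset ℝ≥0} {Ω : Set (Path m)}

/-! ## Integrals are of class `ℳ_b` -/

/-- The functional that vanishes at time zero and equals `φ` afterwards. -/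
def afterZero (φ : Functional Ω (Vec m)) : Functional Ω (Vec m) :=
  fun p => if 0 < p.1.1 then φ p else 0

theorem ev_afterZero (φ : Functional Ω (Vec m)) (t : ℝ≥0) (y : Path m) :
    ev (afterZero φ) t y = if 0 < t then ev φ t y else 0 := by
  by_cases h : (t, y) ∈ Domain Ω <;> simp [ev, afterZero, h]

theorem ev_afterZero_of_pos (φ : Functional Ω (Vec m)) {t : ℝ≥0} (ht : 0 < t) (y : Path m) :
    ev (afterZero φ) t y = ev φ t y := by
  rw [ev_afterZero, if_pos ht]

theorem ev_afterZero_zero (φ : Functional Ω (Vec m)) (y : Path m) :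
    ev (afterZero φ) 0 y = 0 := by
  rw [ev_afterZero, if_neg (lt_irrefl _)]

/-- Cutting off at time zero is harmless from the left: a left approach to zero is constant or void,
and a left approach to `t > 0` is eventually positive. -/
theorem LeftCont.afterZero {φ : Functional Ω (Vec m)} (h : LeftCont π φ) :
    LeftCont π (afterZero φ) where
  a x hx t := by
    rcases eq_zero_or_pos t with rfl | ht
    · rw [ev_afterZero_zero]
      refine tendsto_const_nhds.congr' ?_
      filter_upwards [self_mem_nhdsWithin] with s hs
      rw [nonpos_iff_eq_zero.1 (mem_Iic.1 hs), ev_afterZero_zero]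
    · rw [ev_afterZero_of_pos φ ht]
      refine (h.a x hx t).congr' ?_
      filter_upwards [nhdsWithin_le_nhds (lt_mem_nhds ht)] with s hs
      rw [ev_afterZero_of_pos φ hs]
  b x hx t := by
    rcases eq_zero_or_pos t with rfl | ht
    · rw [show Iio (0 : ℝ≥0) = ∅ from Iio_bot, nhdsWithin_empty]
      exact tendsto_bot
    · rw [ev_afterZero_of_pos φ ht]
      refine (h.b x hx t).congr' ?_
      filter_upwards [nhdsWithin_le_nhds (lt_mem_nhds ht)] with s hs
      rw [ev_afterZero_of_pos φ hs]
  c x hx t u hu hle := by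
    rcases eq_zero_or_pos t with rfl | ht
    · rw [ev_afterZero_zero]
      refine tendsto_const_nhds.congr' ?_
      filter_upwards [hle] with n hn
      rw [prevPt_zero, nonpos_iff_eq_zero] at hn
      rw [hn, ev_afterZero_zero]
    · rw [ev_afterZero_of_pos φ ht]
      refine (h.c x hx t u hu hle).congr' ?_
      filter_upwards [hu.eventually (lt_mem_nhds ht)] with s hs
      rw [ev_afterZero_of_pos φ hs]
  d x hx t u hu hlt := by
    rcases eq_zero_or_pos t with rfl | ht
    · obtain ⟨n, hn⟩ := hlt.exists
      rw [prevPt_zero] at hn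
      exact absurd hn not_lt_zero
    · rw [ev_afterZero_of_pos φ ht]
      refine (h.d x hx t u hu hlt).congr' ?_
      filter_upwards [hu.eventually (lt_mem_nhds ht)] with s hs
      rw [ev_afterZero_of_pos φ hs]

theorem StrictlyCausal.afterZero {φ : Functional Ω (Vec m)} (h : StrictlyCausal φ) :
    StrictlyCausal (afterZero φ) := by
  funext p
  rw [minus, ev_afterZero, PathwiseCalculus.afterZero]
  exact if_congr Iff.rfl (congrFun h p) rfl

theorem LocBounded.afterZero {φ : Functional Ω (Vec m)} (h : LocBounded π φ) :
    LocBounded π (afterZero φ) := by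
  intro x hx T
  obtain ⟨n₀, K, hK⟩ := h x hx T
  refine ⟨n₀, K, fun n hn t ht => ?_⟩
  have := hK n hn t ht
  rw [ev_afterZero]
  split_ifs
  · exact this
  · rw [norm_zero]
    exact (norm_nonneg _).trans this

theorem bump_mem_domain {x : Path m} {t : ℝ≥0} {e : Vec m} (h : bump x t e ∈ Ω) :
    (t, bump x t e) ∈ Domain Ω :=
  mem_domain_of_stopAt_eq h (stopAt_bump x le_rfl e)

/-- At time zero a bump changes F and its initial value by the same amount, so the gradient is zero;
at later times the initial value does not see the bump. -/
theorem hasGradientAt_sub_initialValue (hΩ : IsGeneric π Ω) {F : Functional Ω ℝ}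
    (hv : VertDifferentiable F) (p : Domain Ω) :
    HasGradientAt (fun e : Vec m => ev (F - initialValue F) p.1.1 (bump p.1.2 p.1.1 e))
      (afterZero (vertDeriv F) p) 0 := by
  obtain ⟨⟨t, y⟩, hp⟩ := p
  have hy := hΩ.mem_of_mem_domain hp
  obtain ⟨U, hU, -, -, h⟩ := hΩ.vertical y hy t
  simp only [afterZero]
  have hval : ∀ᶠ e in 𝓝 (0 : Vec m), ev (F - initialValue F) t (bump y t e) =
      ev F t (bump y t e) - ev F 0 (stopAt (bump y t e) 0) := by
    filter_upwards [hU] with e he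
    rw [ev_sub, ev_initialValue F (bump_mem_domain (h e he))]
  rw [hasGradientAt_iff_hasFDerivAt]
  rcases eq_zero_or_pos t with rfl | ht
  · rw [if_neg (lt_irrefl _), map_zero]
    refine (hasFDerivAt_const (0 : ℝ) (0 : Vec m)).congr_of_eventuallyEq ?_
    filter_upwards [hval] with e he
    rw [he, stopAt_bump y le_rfl, sub_self]
  · rw [if_pos ht]
    have hg := (hv ⟨_, hp⟩).hasGradientAt.hasFDerivAt.sub_const (ev F 0 (stopAt y 0))
    refine hg.congr_of_eventuallyEq ?_
    filter_upwards [hval] with e he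
    rw [he, stopAt_congr (x := bump y t e) (y := y) fun s hs => bump_of_lt e (hs.trans_lt ht)]

theorem vertDeriv_sub_initialValue (hΩ : IsGeneric π Ω) {F : Functional Ω ℝ}
    (hv : VertDifferentiable F) :
    vertDeriv (F - initialValue F) = afterZero (vertDeriv F) :=
  funext fun p => (hasGradientAt_sub_initialValue hΩ hv p).gradient

theorem horizQuot_sub_initialValue (hΩ : IsGeneric π Ω) (F : Functional Ω ℝ) :
    horizQuot (F - initialValue F) = horizQuot F := by
  funext p h
  have hs := stopAt_eq_of_mem_domain p.2
  have hp : (p.1.1 + h, p.1.2) ∈ Domain Ω := by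
    refine mem_domain_of_stopAt_eq (hΩ.mem_of_mem_domain p.2) ?_
    conv_lhs => rw [← hs]
    rw [stopAt_stopAt_of_ge _ le_self_add, hs]
  rw [horizQuot, horizQuot, ev_sub, ev_sub, ev_initialValue F hp, ev_initialValue F p.2,
    sub_sub_sub_cancel_right]

theorem classMb_sub_initialValue (hπ : IsPartitionSeq π) (hΩ : IsGeneric π Ω)
    {F : Functional Ω ℝ} (hF : ClassMb π F) : ClassMb π (F - initialValue F) := by
  have hh : horizDeriv (F - initialValue F) = horizDeriv F := by
    funext p
    rw [horizDeriv, horizDeriv, horizQuot_sub_initialValue hΩ]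
  have hvd := vertDeriv_sub_initialValue hΩ hF.1.1.vert
  refine ⟨⟨⟨?_, ?_, ?_, ?_, ?_, ?_, ?_⟩, ?_⟩, ?_⟩
  · exact sub_mem hF.1.1.cont (initialValue_mem_cpi hπ hΩ hF.1.1.cont)
  · intro p
    rw [horizQuot_sub_initialValue hΩ]
    exact hF.1.1.horiz p
  · exact fun p => (hasGradientAt_sub_initialValue hΩ hF.1.1.vert p).differentiableAt
  · exact hh ▸ hF.1.1.horiz_right
  · exact hh ▸ hF.1.1.horiz_bdd
  · exact hvd ▸ hF.1.1.vert_left.afterZero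
  · exact hvd ▸ hF.1.1.vert_causal.afterZero
  · exact hh.trans hF.1.2
  · exact hvd ▸ hF.2.afterZero

/-! ## Properties of the integrands in `𝔏_b` -/

section Lb

variable {φ ψ : Functional Ω (Vec m)}

theorem classMb_pathInt (hπ : IsPartitionSeq π) (hΩ : IsGeneric π Ω) (hφ : φ ∈ Lb π Ω) :
    ClassMb π (pathInt π φ) := by
  obtain ⟨F, hF, rfl⟩ := hφ
  rw [pathInt_vertDeriv hπ hΩ hF.1]
  exact classMb_sub_initialValue hπ hΩ hF

theorem vertDeriv_pathInt (hπ : IsPartitionSeq π) (hΩ : IsGeneric π Ω) (hφ : φ ∈ Lb π Ω) :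
    vertDeriv (pathInt π φ) = afterZero φ := by
  obtain ⟨F, hF, rfl⟩ := hφ
  rw [pathInt_vertDeriv hπ hΩ hF.1, vertDeriv_sub_initialValue hΩ hF.1.1.vert]

theorem pathIntegrable_of_mem_Lb (hπ : IsPartitionSeq π) (hΩ : IsGeneric π Ω)
    (hφ : φ ∈ Lb π Ω) : PathIntegrable π φ := by
  obtain ⟨F, hF, rfl⟩ := hφ
  exact pathIntegrable_vertDeriv hπ hΩ hF.1

theorem leftCont_of_mem_Lb (hφ : φ ∈ Lb π Ω) : LeftCont π φ := by
  obtain ⟨F, hF, rfl⟩ := hφ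
  exact hF.1.1.vert_left

theorem strictlyCausal_of_mem_Lb (hφ : φ ∈ Lb π Ω) : StrictlyCausal φ := by
  obtain ⟨F, hF, rfl⟩ := hφ
  exact hF.1.1.vert_causal

theorem locBounded_of_mem_Lb (hφ : φ ∈ Lb π Ω) : LocBounded π φ := by
  obtain ⟨F, hF, rfl⟩ := hφ
  exact hF.2

theorem ev_pathInt_zero (hπ : IsPartitionSeq π) (hΩ : IsGeneric π Ω) (hφ : φ ∈ Lb π Ω)
    {y : Path m} (hy : (0, y) ∈ Domain Ω) : ev (pathInt π φ) 0 y = 0 := by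
  obtain ⟨F, hF, rfl⟩ := hφ
  rw [ev_pathInt_vertDeriv hπ hΩ hF.1 hy, stopAt_eq_of_mem_domain hy, sub_self]

theorem tendsto_riemannSum_of_mem_Lb (hπ : IsPartitionSeq π) (hΩ : IsGeneric π Ω)
    (hφ : φ ∈ Lb π Ω) (p : Domain Ω) :
    Tendsto (fun n => riemannSum (π n) φ p.1.1 p.1.2) atTop (𝓝 (pathInt π φ p)) := by
  have h := (pathIntegrable_of_mem_Lb hπ hΩ hφ).conv p.1.2 (hΩ.mem_of_mem_domain p.2) p.1.1
  rwa [stopAt_eq_of_mem_domain p.2, ev_coe] at h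

theorem riemannSum_add (P : Finset ℝ≥0) (φ ψ : Functional Ω (Vec m)) (t : ℝ≥0) (x : Path m) :
    riemannSum P (φ + ψ) t x = riemannSum P φ t x + riemannSum P ψ t x := by
  simp only [riemannSum, ev_add, inner_add_left, Finset.sum_add_distrib]

theorem riemannSum_smul (P : Finset ℝ≥0) (r : ℝ) (φ : Functional Ω (Vec m)) (t : ℝ≥0)
    (x : Path m) : riemannSum P (r • φ) t x = r * riemannSum P φ t x := by
  simp only [riemannSum, ev_smul, real_inner_smul_left, Finset.mul_sum]

theorem pathInt_add (hπ : IsPartitionSeq π) (hΩ : IsGeneric π Ω) (hφ : φ ∈ Lb π Ω)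
    (hψ : ψ ∈ Lb π Ω) : pathInt π (φ + ψ) = pathInt π φ + pathInt π ψ := by
  funext p
  have h := (tendsto_riemannSum_of_mem_Lb hπ hΩ hφ p).add (tendsto_riemannSum_of_mem_Lb hπ hΩ hψ p)
  simp only [← riemannSum_add] at h
  exact h.limUnder_eq

theorem pathInt_smul (hπ : IsPartitionSeq π) (hΩ : IsGeneric π Ω) (hφ : φ ∈ Lb π Ω) (r : ℝ) :
    pathInt π (r • φ) = r • pathInt π φ := by
  funext p
  have h := (tendsto_riemannSum_of_mem_Lb hπ hΩ hφ p).const_mul r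
  simp only [← riemannSum_smul] at h
  exact h.limUnder_eq

/-- Only the first summand survives, and it vanishes in the limit; so the integral ignores the
integrand at time zero. -/
theorem tendsto_riemannSum_of_eq_zero (hπ : IsPartitionSeq π) (hΩ : IsGeneric π Ω)
    (hφ : LeftCont π φ) (h : ∀ p : Domain Ω, 0 < p.1.1 → φ p = 0) {x : Path m} (hx : x ∈ Ω)
    (t : ℝ≥0) : Tendsto (fun n => riemannSum (π n) φ t x) atTop (𝓝 0) := by
  refine (tendsto_initial_term hπ hΩ hφ hx).congr fun n => ?_
  rw [riemannSum, sum_filter_le_eq_add (hπ.zero_mem n), left_eq_add]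
  refine Finset.sum_eq_zero fun s hs => ?_
  rw [Finset.mem_filter] at hs
  have : ev φ s (stopLeft (pcApprox (π n) x) s) = 0 := by
    rw [ev]
    split_ifs with hm
    exacts [h _ hs.2.1, rfl]
  rw [this, inner_zero_left]

theorem pathInt_eq_zero (hπ : IsPartitionSeq π) (hΩ : IsGeneric π Ω) (hφ : LeftCont π φ)
    (h : ∀ p : Domain Ω, 0 < p.1.1 → φ p = 0) : pathInt π φ = 0 :=
  funext fun p =>
    (tendsto_riemannSum_of_eq_zero hπ hΩ hφ h (hΩ.mem_of_mem_domain p.2) p.1.1).limUnder_eq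

theorem minus_add {V : Type*} [AddZeroClass V] (F G : Functional Ω V) :
    minus (F + G) = minus F + minus G :=
  funext fun _ => ev_add F G _ _

theorem minus_smul {V : Type*} [Zero V] {R : Type*} [SMulZeroClass R V] (r : R)
    (F : Functional Ω V) : minus (r • F) = r • minus F :=
  funext fun _ => ev_smul r F _ _

theorem bracket_comm (φ ψ : Functional Ω (Vec m)) : bracket π φ ψ = bracket π ψ φ := by
  simp only [bracket, add_comm]

theorem bracket_add_left (hπ : IsPartitionSeq π) (hΩ : IsGeneric π Ω)
    {φ' : Functional Ω (Vec m)} (hφ : φ ∈ Lb π Ω) (hφ' : φ' ∈ Lb π Ω) :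
    bracket π (φ + φ') ψ = bracket π φ ψ + bracket π φ' ψ := by
  rw [bracket, bracket, bracket, ← minus_add, pathInt_add hπ hΩ hφ hφ']
  congr 1
  funext p
  simp only [Pi.add_apply, add_smul, smul_add]
  abel

theorem bracket_smul_left (hπ : IsPartitionSeq π) (hΩ : IsGeneric π Ω) (hφ : φ ∈ Lb π Ω) (r : ℝ) :
    bracket π (r • φ) ψ = r • bracket π φ ψ := by
  rw [bracket, bracket, ← minus_smul, pathInt_smul hπ hΩ hφ]
  congr 1
  funext p
  simp only [Pi.smul_apply, smul_add, smul_eq_mul, mul_smul]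
  rw [smul_comm r (pathInt π ψ p)]

end Lb

/-! ## The discrete product rule -/

theorem ev_bracket (hΩ : IsGeneric π Ω) (φ ψ : Functional Ω (Vec m)) {x : Path m} (hx : x ∈ Ω)
    (t : ℝ≥0) :
    ev (bracket π φ ψ) t (stopLeft x t) =
      ev (pathInt π φ) t (stopLeft x t) • ev ψ t (stopLeft x t) +
      ev (pathInt π ψ) t (stopLeft x t) • ev φ t (stopLeft x t) := by
  have hm := hΩ.stopLeft_mem_domain hx t
  rw [bracket, ev_minus hΩ _ hx, ev_of_mem _ hm, ev_of_mem _ hm, ev_of_mem _ hm, ev_of_mem _ hm,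
    ev_of_mem _ hm]

/-- The sum of the products of the increments of two pathwise integrals. -/
def prodSum (P : Finset ℝ≥0) (φ ψ : Functional Ω (Vec m)) (t : ℝ≥0) (x : Path m) : ℝ :=
  ∑ s ∈ P.filter (fun s => s ≤ t),
    inner ℝ (ev φ s (stopLeft (pcApprox P x) s)) (x (nextPt P s) - x s) *
      inner ℝ (ev ψ s (stopLeft (pcApprox P x) s)) (x (nextPt P s) - x s)

section ProductRule

variable {φ ψ : Functional Ω (Vec m)}

/-- Telescoping `XY - X₋Y₋ = X₋ΔY + Y₋ΔX + ΔXΔY` over the partition points: the mixed terms form the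
Riemann sum of the bracket. `prodSum` also counts time zero, where nothing jumps, so that term is
subtracted. -/
theorem ev_mul_ev_pathInt (hπ : IsPartitionSeq π) (hΩ : IsGeneric π Ω) (hφ : φ ∈ Lb π Ω)
    (hψ : ψ ∈ Lb π Ω) {P : Finset ℝ≥0} (h0 : 0 ∈ P) {x : Path m} {T : ℝ≥0} (hT : T < lastPt P)
    (hx : stopAt (pcApprox P x) T ∈ Ω) :
    ev (pathInt π φ) T (stopAt (pcApprox P x) T) * ev (pathInt π ψ) T (stopAt (pcApprox P x) T) =
      riemannSum P (bracket π φ ψ) T x + (prodSum P φ ψ T x -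
        inner ℝ (ev φ 0 (stopLeft (pcApprox P x) 0)) (x (nextPt P 0) - x 0) *
          inner ℝ (ev ψ 0 (stopLeft (pcApprox P x) 0)) (x (nextPt P 0) - x 0)) := by
  have hbr : ∀ s ≤ T, ev (bracket π φ ψ) s (stopLeft (pcApprox P x) s) =
      ev (pathInt π φ) s (stopLeft (pcApprox P x) s) • ev ψ s (stopLeft (pcApprox P x) s) +
      ev (pathInt π ψ) s (stopLeft (pcApprox P x) s) • ev φ s (stopLeft (pcApprox P x) s) := by
    intro s hs
    rw [← stopLeft_stopAt_of_stopAt_mem hΩ hx hs]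
    exact ev_bracket hΩ φ ψ hx s
  have hzero : ∀ {χ : Functional Ω (Vec m)}, χ ∈ Lb π Ω →
      ev (pathInt π χ) 0 (stopAt (pcApprox P x) 0) = 0 := fun hχ => by
    refine ev_pathInt_zero hπ hΩ hχ ?_
    rw [← stopAt_stopAt_of_le _ (zero_le : 0 ≤ T)]
    exact stopAt_mem_domain hx 0
  have hstep : ∀ {χ : Functional Ω (Vec m)}, χ ∈ Lb π Ω → ∀ s ∈ P, 0 < s → s ≤ T →
      ev (pathInt π χ) s (stopAt (pcApprox P x) s) =
        ev (pathInt π χ) s (stopLeft (pcApprox P x) s) +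
        inner ℝ (ev χ s (stopLeft (pcApprox P x) s)) (x (nextPt P s) - x s) :=
    fun hχ s hs hpos hsT => by
      rw [ev_stopAt_pcApprox_eq_add hΩ (classMb_pathInt hπ hΩ hχ).1 h0 hT hx hs hpos hsT,
        vertDeriv_pathInt hπ hΩ hχ, ev_afterZero_of_pos _ hpos]
  have h := sub_eq_sum_of_step h0 (T := T)
    (Φ := fun t => ev (pathInt π φ) t (stopAt (pcApprox P x) t) *
      ev (pathInt π ψ) t (stopAt (pcApprox P x) t))
    (c := fun s => inner ℝ (ev (bracket π φ ψ) s (stopLeft (pcApprox P x) s))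
      (x (nextPt P s) - x s) +
      inner ℝ (ev φ s (stopLeft (pcApprox P x) s)) (x (nextPt P s) - x s) *
      inner ℝ (ev ψ s (stopLeft (pcApprox P x) s)) (x (nextPt P s) - x s)) ?_ ?_ le_rfl
  · simp only [hzero hφ, hzero hψ, mul_zero, sub_zero, Finset.sum_add_distrib] at h
    -- Both integrals vanish at time zero, hence so does the bracket.
    rw [h, riemannSum, prodSum, sum_filter_le_eq_add h0, sum_filter_le_eq_add h0, hbr 0 zero_le,
      stopLeft_zero, hzero hφ, hzero hψ, zero_smul, zero_smul, zero_add, inner_zero_left]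
    ring
  · intro s hs hpos hsT
    rw [← ev_stopLeft_pcApprox hΩ (classMb_pathInt hπ hΩ hφ).1 h0 hx hpos hsT,
      ← ev_stopLeft_pcApprox hΩ (classMb_pathInt hπ hΩ hψ).1 h0 hx hpos hsT,
      hstep hφ s hs hpos hsT, hstep hψ s hs hpos hsT, hbr s hsT, inner_add_left,
      real_inner_smul_left, real_inner_smul_left]
    ring
  · intro s _ t htT hst hq
    rw [ev_stopAt_pcApprox_congr hΩ (classMb_pathInt hπ hΩ hφ).1 hx hst htT hq,
      ev_stopAt_pcApprox_congr hΩ (classMb_pathInt hπ hΩ hψ).1 hx hst htT hq]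

theorem tendsto_prodSum (hπ : IsPartitionSeq π) (hΩ : IsGeneric π Ω) (hφ : φ ∈ Lb π Ω)
    (hψ : ψ ∈ Lb π Ω) (hb : bracket π φ ψ ∈ Lb π Ω) (p : Domain Ω) :
    Tendsto (fun n => prodSum (π n) φ ψ p.1.1 p.1.2) atTop
      (𝓝 (pathInt π φ p * pathInt π ψ p - pathInt π (bracket π φ ψ) p)) := by
  have hx := hΩ.mem_of_mem_domain p.2
  have hs := stopAt_eq_of_mem_domain p.2
  have h1 := tendsto_ev_stopAt_pcApprox hπ hΩ (classMb_pathInt hπ hΩ hφ).1.1.cont hx p.1.1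
  have h2 := tendsto_ev_stopAt_pcApprox hπ hΩ (classMb_pathInt hπ hΩ hψ).1.1.cont hx p.1.1
  rw [hs, ev_coe] at h1 h2
  have h3 := (tendsto_initial_term hπ hΩ (leftCont_of_mem_Lb hφ) hx).mul
    (tendsto_initial_term hπ hΩ (leftCont_of_mem_Lb hψ) hx)
  have h := ((h1.mul h2).sub (tendsto_riemannSum_of_mem_Lb hπ hΩ hb p)).add h3
  rw [mul_zero, add_zero] at h
  refine h.congr' ?_
  filter_upwards [hΩ.eventually_approx_mem hx p.1.1, hπ.eventually_lt_lastPt p.1.1] with n hn hT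
  rw [ev_mul_ev_pathInt hπ hΩ hφ hψ (hπ.zero_mem n) hT hn]
  ring

end ProductRule

end

section

/-! ## Quantile functions of finite measures on the half-line -/

/-- The quantile function `y ↦ inf {t | y ≤ μ [0, t]}`. -/
def quantile (μ : Measure ℝ≥0) (y : ℝ) : ℝ≥0 := sInf {t | y ≤ μ.real (Iic t)}

section Quantile

variable {μ : Measure ℝ≥0} [IsFiniteMeasure μ] {T : ℝ≥0}

theorem monotone_real_Iic : Monotone fun t => μ.real (Iic t) := fun _ _ h =>
  measureReal_mono (Iic_subset_Iic.2 h)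

/-- Right-continuity of the distribution function, by continuity from above. -/
theorem le_real_Iic_of_forall_gt {y : ℝ} {t : ℝ≥0} (h : ∀ s, t < s → y ≤ μ.real (Iic s)) :
    y ≤ μ.real (Iic t) := by
  have h1 := tendsto_measure_biInter_gt (μ := μ) (s := fun s : ℝ≥0 => Iic s) (a := t)
    (fun r _ => measurableSet_Iic.nullMeasurableSet) (fun i j _ hij => Iic_subset_Iic.2 hij)
    ⟨t + 1, lt_add_one t, measure_ne_top _ _⟩
  have h2 : (⋂ r > t, Iic r) = Iic t := by
    ext q
    simp only [mem_iInter, mem_Iic]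
    exact ⟨fun h => le_of_forall_gt_imp_ge_of_dense h, fun h r hr => h.trans hr.le⟩
  rw [h2] at h1
  have h3 := (ENNReal.tendsto_toReal (measure_ne_top μ _)).comp h1
  exact ge_of_tendsto h3 (eventually_nhdsWithin_of_forall h)

/-- For levels that are reached, right-continuity makes the infimum a minimum; this Galois property
is all that is used about quantiles. -/
theorem quantile_le_iff {y : ℝ} {t : ℝ≥0} (hy : y ≤ μ.real (Iic T)) :
    quantile μ y ≤ t ↔ y ≤ μ.real (Iic t) := by
  refine ⟨fun h => ?_, fun h => csInf_le (OrderBot.bddBelow _) h⟩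
  refine le_trans ?_ (monotone_real_Iic h)
  refine le_real_Iic_of_forall_gt fun s hs => ?_
  obtain ⟨r, hr, hrs⟩ := (csInf_lt_iff (OrderBot.bddBelow _) ⟨T, hy⟩).1 hs
  exact le_trans hr (monotone_real_Iic hrs.le)

theorem lt_quantile_iff {y : ℝ} {t : ℝ≥0} (hy : y ≤ μ.real (Iic T)) :
    t < quantile μ y ↔ μ.real (Iic t) < y := by
  rw [← not_le, quantile_le_iff hy, not_le]

theorem quantile_le {y : ℝ} (hy : y ≤ μ.real (Iic T)) : quantile μ y ≤ T :=
  (quantile_le_iff hy).2 hy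

theorem monotoneOn_quantile (T : ℝ≥0) : MonotoneOn (quantile μ) (Iic (μ.real (Iic T))) :=
  fun _ hy _ hy' h => (quantile_le_iff hy).2 (h.trans ((quantile_le_iff hy').1 le_rfl))

theorem aemeasurable_quantile (T : ℝ≥0) :
    AEMeasurable (quantile μ) (volume.restrict (Ioc 0 (μ.real (Iic T)))) :=
  aemeasurable_restrict_of_monotoneOn measurableSet_Ioc
    ((monotoneOn_quantile T).mono Ioc_subset_Iic_self)

/-- Inverse transform sampling: the preimage of `[0, t]` is the interval of levels up to `μ [0, t]`.
-/
theorem map_quantile (hT : μ (Ioi T) = 0) :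
    (volume.restrict (Ioc 0 (μ.real (Iic T)))).map (quantile μ) = μ := by
  symm
  refine Measure.ext_of_Iic _ _ fun t => ?_
  rw [Measure.map_apply_of_aemeasurable (aemeasurable_quantile T) measurableSet_Iic,
    Measure.restrict_apply' measurableSet_Ioc]
  have hle : μ.real (Iic t) ≤ μ.real (Iic T) := by
    refine ENNReal.toReal_mono (measure_ne_top _ _) ?_
    calc μ (Iic t) ≤ μ (Iic T ∪ Ioi T) := measure_mono (by rw [Iic_union_Ioi]; exact subset_univ _)
      _ ≤ μ (Iic T) + μ (Ioi T) := measure_union_le _ _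
      _ = μ (Iic T) := by rw [hT, add_zero]
  have : quantile μ ⁻¹' Iic t ∩ Ioc 0 (μ.real (Iic T)) = Ioc 0 (μ.real (Iic t)) := by
    ext y
    simp only [mem_inter_iff, mem_preimage, mem_Iic, mem_Ioc]
    constructor
    · rintro ⟨h1, h2, h3⟩
      exact ⟨h2, (quantile_le_iff h3).1 h1⟩
    · rintro ⟨h1, h2⟩
      exact ⟨(quantile_le_iff (h2.trans hle)).2 h2, h1, h2.trans hle⟩
  rw [this, Real.volume_Ioc, sub_zero, ofReal_measureReal]

theorem integral_eq_integral_quantile (hT : μ (Ioi T) = 0) {f : ℝ≥0 → ℝ}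
    (hf : AEStronglyMeasurable f μ) :
    ∫ s, f s ∂μ = ∫ y in Ioc 0 (μ.real (Iic T)), f (quantile μ y) := by
  conv_lhs => rw [← map_quantile hT]
  exact integral_map (aemeasurable_quantile T) (by rwa [map_quantile hT])

theorem aestronglyMeasurable_comp_quantile (hT : μ (Ioi T) = 0) {f : ℝ≥0 → ℝ}
    (hf : AEStronglyMeasurable f μ) :
    AEStronglyMeasurable (fun y => f (quantile μ y)) (volume.restrict (Ioc 0 (μ.real (Iic T)))) :=
  AEStronglyMeasurable.comp_aemeasurable (by rwa [map_quantile hT]) (aemeasurable_quantile T)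

end Quantile

/-! ## Convergence of integrals under time changes -/

section TimeChange

variable {μs : ℕ → Measure ℝ≥0} {μ : Measure ℝ≥0} [∀ n, IsFiniteMeasure (μs n)]
  [IsFiniteMeasure μ] {T : ℝ≥0} {τ : ℕ → ℝ≥0 ≃o ℝ≥0}

theorem tendsto_apply_of_tendstoUniformly_id
    (hτ : TendstoUniformly (fun n s => τ n s) id atTop) {v : ℕ → ℝ≥0} {s : ℝ≥0}
    (hv : Tendsto v atTop (𝓝 s)) : Tendsto (fun n => τ n (v n)) atTop (𝓝 s) :=
  hτ.tendsto_comp continuousAt_id hv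

/-- The levels that are excluded in the pointwise convergence of the quantile functions. -/
def exceptionalLevels (μ : Measure ℝ≥0) (T : ℝ≥0) (B : Set ℝ≥0) : Set ℝ :=
  {μ.real (Iic T)} ∪
  (fun s => μ.real (Iic s)) '' {s | ∃ c, c < μ.real (Iic s) ∧ ∀ r < s, μ.real (Iic r) ≤ c} ∪
  (fun s => Function.leftLim (fun s => μ.real (Iic s)) s) ''
    {s | ∃ c, c < μ.real (Iic s) ∧ ∀ r < s, μ.real (Iic r) ≤ c} ∪
  {y ∈ Iic (μ.real (Iic T)) | ∃ z, quantile μ y < z ∧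
    ∀ y' ∈ Iic (μ.real (Iic T)), y < y' → z ≤ quantile μ y'} ∪
  (fun s => μ.real (Iic s)) '' B

omit [IsFiniteMeasure μ] in
theorem countable_exceptionalLevels {B : Set ℝ≥0} (hB : B.Countable) :
    (exceptionalLevels μ T B).Countable := by
  have h : {s : ℝ≥0 | ∃ c, c < μ.real (Iic s) ∧ ∀ r < s, μ.real (Iic r) ≤ c}.Countable :=
    countable_image_lt_image_Iio (fun s : ℝ≥0 => μ.real (Iic s))
  exact ((((countable_singleton _).union (h.image _)).union (h.image _)).union
    (countable_image_lt_image_Ioi_within _ _)).union (hB.image _)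

/-- Let `s` be the limiting quantile. If the limit distribution jumps at `s`, then `y` lies strictly
inside the jump and the quantiles eventually equal `τ n s`. Otherwise the distribution crosses level
`y` at `s` without staying flat, so the quantiles converge to `s ∉ B`. -/
theorem tendsto_comp_quantile
    (hτ : TendstoUniformly (fun n s => τ n s) id atTop)
    (hk : ∀ R : ℝ≥0, TendstoUniformlyOn (fun n s => (μs n).real (Iic (τ n s)))
      (fun s => μ.real (Iic s)) atTop (Iic R))
    (hM : Tendsto (fun n => (μs n).real (Iic T)) atTop (𝓝 (μ.real (Iic T))))
    {fs : ℕ → ℝ≥0 → ℝ} {f : ℝ≥0 → ℝ} {B : Set ℝ≥0}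
    (hnb : ∀ s ∉ B, ∀ u : ℕ → ℝ≥0, Tendsto u atTop (𝓝 s) →
      Tendsto (fun n => fs n (u n)) atTop (𝓝 (f s)))
    (hj : ∀ s c, c < μ.real (Iic s) → (∀ r < s, μ.real (Iic r) ≤ c) →
      Tendsto (fun n => fs n (τ n s)) atTop (𝓝 (f s)))
    {y : ℝ} (hy : y < μ.real (Iic T)) (hyE : y ∉ exceptionalLevels μ T B) :
    Tendsto (fun n => fs n (quantile (μs n) y)) atTop (𝓝 (f (quantile μ y))) := by
  -- The level is neither the value (`hE1`) nor the left limit (`hE2`) at a jump, nor the level of a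
  -- flat stretch (`hE3`), nor a value at a point of `B` (`hE4`).
  simp only [exceptionalLevels, mem_union, not_or] at hyE
  obtain ⟨⟨⟨⟨-, hE1⟩, hE2⟩, hE3⟩, hE4⟩ := hyE
  set s := quantile μ y with hs
  have hys : y ≤ μ.real (Iic s) := (quantile_le_iff hy.le).1 le_rfl
  have hlt : ∀ r < s, μ.real (Iic r) < y := fun r hr => (lt_quantile_iff hy.le).1 hr
  have hyn : ∀ᶠ n in atTop, y < (μs n).real (Iic T) := hM.eventually_const_lt hy
  have hpt : ∀ r, Tendsto (fun n => (μs n).real (Iic (τ n r))) atTop (𝓝 (μ.real (Iic r))) :=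
    fun r => (hk r).tendsto_at (mem_Iic.2 le_rfl)
  by_cases hjump : ∃ c, c < μ.real (Iic s) ∧ ∀ r < s, μ.real (Iic r) ≤ c
  · obtain ⟨c, hc, hcs⟩ := hjump
    have hys' : y < μ.real (Iic s) :=
      hys.lt_of_ne fun h => hE1 ⟨s, ⟨c, hc, hcs⟩, h.symm⟩
    refine (hj s c hc hcs).congr' ?_
    -- A bound strictly below `y` for everything before `s`: the left limit, or any number below `y`
    -- if `s = 0`, where nothing precedes.
    have hc' : ∃ c' < y, ∀ r < s, μ.real (Iic r) ≤ c' := by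
      rcases eq_zero_or_pos s with h0 | hpos
      · exact ⟨y - 1, by linarith, fun r hr => absurd (h0 ▸ hr) not_lt_zero⟩
      · have hne := nhdsLT_neBot hpos
        have hmono : Monotone fun s => μ.real (Iic s) := monotone_real_Iic
        refine ⟨Function.leftLim (fun s => μ.real (Iic s)) s, ?_, fun r hr => hmono.le_leftLim hr⟩
        refine lt_of_le_of_ne ?_ fun h => hE2 ⟨s, ⟨c, hc, hcs⟩, h⟩
        exact le_of_tendsto (hmono.tendsto_leftLim s)
          (eventually_nhdsWithin_of_forall fun r hr => (hlt r hr).le)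
    obtain ⟨c', hc'y, hc's⟩ := hc'
    have hunif := Metric.tendstoUniformlyOn_iff.1 (hk s) (y - c') (sub_pos.2 hc'y)
    filter_upwards [hyn, (hpt s).eventually_const_lt hys', hunif] with n h1 h2 h3
    congr 1
    refine le_antisymm (not_lt.1 fun h => ?_) ((quantile_le_iff h1.le).2 h2.le)
    obtain ⟨r, hr⟩ := (τ n).surjective (quantile (μs n) y)
    have hrs : r < s := (τ n).lt_iff_lt.1 (hr ▸ h)
    have h4 := (quantile_le_iff h1.le).1 hr.ge
    have h5 := (abs_sub_lt_iff.1 (Real.dist_eq _ _ ▸ h3 r hrs.le)).2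
    linarith [hc's r hrs]
  · have hyeq : y = μ.real (Iic s) := hys.antisymm <| not_lt.1 fun h =>
      hjump ⟨y, h, fun r hr => (hlt r hr).le⟩
    have hsB : s ∉ B := fun h => hE4 ⟨s, h, hyeq.symm⟩
    refine hnb s hsB _ ?_
    -- If the distribution were still at level `y` at `r > s`, the quantile function would leap from
    -- `s` past `r` just above `y`.
    have hgt : ∀ r, s < r → y < μ.real (Iic r) := fun r hr => by
      refine (hyeq.le.trans (monotone_real_Iic hr.le)).lt_of_ne fun h => hE3 ⟨hy.le, r, hr, ?_⟩
      intro y' hy' hlt'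
      refine ((lt_quantile_iff hy').2 ?_).le
      exact (show y = μ.real (Iic r) from h) ▸ hlt'
    have hv : Tendsto (fun n => (τ n).symm (quantile (μs n) y)) atTop (𝓝 s) := by
      refine tendsto_order.2 ⟨fun r hr => ?_, fun r hr => ?_⟩
      · filter_upwards [hyn, (hpt r).eventually_lt_const (hlt r hr)] with n h1 h2
        rw [(τ n).lt_symm_apply]
        exact (lt_quantile_iff h1.le).2 h2
      · obtain ⟨q, hsq, hqr⟩ := exists_between hr
        filter_upwards [hyn, (hpt q).eventually_const_lt (hgt q hsq)] with n h1 h2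
        refine lt_of_le_of_lt ?_ hqr
        rw [(τ n).symm_apply_le]
        exact (quantile_le_iff h1.le).2 h2.le
    simpa using tendsto_apply_of_tendstoUniformly_id hτ hv

/-- Substitution of quantiles turns the varying measures into Lebesgue measure on intervals of
levels, where dominated convergence applies. -/
theorem tendsto_integral_of_timeChange (hTn : ∀ n, μs n (Ioi T) = 0) (hT : μ (Ioi T) = 0)
    (hτ : TendstoUniformly (fun n s => τ n s) id atTop)
    (hk : ∀ R : ℝ≥0, TendstoUniformlyOn (fun n s => (μs n).real (Iic (τ n s)))
      (fun s => μ.real (Iic s)) atTop (Iic R))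
    {fs : ℕ → ℝ≥0 → ℝ} {f : ℝ≥0 → ℝ} (hfs : ∀ n, AEStronglyMeasurable (fs n) (μs n))
    (hf : AEStronglyMeasurable f μ) {K : ℝ} (hK : ∀ᶠ n in atTop, ∀ s ≤ T, |fs n s| ≤ K)
    {B : Set ℝ≥0} (hB : B.Countable)
    (hnb : ∀ s ∉ B, ∀ u : ℕ → ℝ≥0, Tendsto u atTop (𝓝 s) →
      Tendsto (fun n => fs n (u n)) atTop (𝓝 (f s)))
    (hj : ∀ s c, c < μ.real (Iic s) → (∀ r < s, μ.real (Iic r) ≤ c) →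
      Tendsto (fun n => fs n (τ n s)) atTop (𝓝 (f s))) :
    Tendsto (fun n => ∫ s, fs n s ∂(μs n)) atTop (𝓝 (∫ s, f s ∂μ)) := by
  have htot : ∀ (ν : Measure ℝ≥0) [IsFiniteMeasure ν], ν (Ioi T) = 0 → ∀ s, T ≤ s →
      ν.real (Iic s) = ν.real (Iic T) := by
    intro ν _ hν s hs
    refine le_antisymm ?_ (monotone_real_Iic hs)
    refine ENNReal.toReal_mono (measure_ne_top _ _) ?_
    calc ν (Iic s) ≤ ν (Iic T ∪ Ioi T) := measure_mono (by rw [Iic_union_Ioi]; exact subset_univ _)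
      _ ≤ ν (Iic T) + ν (Ioi T) := measure_union_le _ _
      _ = ν (Iic T) := by rw [hν, add_zero]
  -- The time change may move `T` itself to the left; at `T + 1` its images eventually lie beyond
  -- `T`, where all mass is counted.
  have hM : Tendsto (fun n => (μs n).real (Iic T)) atTop (𝓝 (μ.real (Iic T))) := by
    have h := (hk (T + 1)).tendsto_at (mem_Iic.2 le_rfl)
    rw [htot μ hT _ le_self_add] at h
    refine h.congr' ?_
    have h2 := tendsto_apply_of_tendstoUniformly_id hτ (tendsto_const_nhds (x := T + 1))
    filter_upwards [h2.eventually_const_le (lt_add_one T)] with n hn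
    exact htot (μs n) (hTn n) _ hn
  rw [integral_eq_integral_quantile hT hf, ← integral_indicator measurableSet_Ioc]
  simp only [fun n => integral_eq_integral_quantile (hTn n) (hfs n)]
  simp only [← integral_indicator (μ := volume) (measurableSet_Ioc (α := ℝ))]
  have hbound : Integrable ((Ioc 0 (μ.real (Iic T) + 1)).indicator fun _ => K) volume :=
    (integrable_indicator_iff measurableSet_Ioc).2 (integrableOn_const (by simp))
  refine tendsto_integral_filter_of_dominated_convergence _
    (Eventually.of_forall fun n => ?_) ?_ hbound ?_
  · exact (aestronglyMeasurable_indicator_iff measurableSet_Ioc).2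
      (aestronglyMeasurable_comp_quantile (hTn n) (hfs n))
  · filter_upwards [hK, hM.eventually_le_const (lt_add_one _)] with n hn hMn
    refine Eventually.of_forall fun y => ?_
    by_cases hy : y ∈ Ioc 0 ((μs n).real (Iic T))
    · rw [indicator_of_mem hy, indicator_of_mem (mem_Ioc.2 ⟨hy.1, hy.2.trans hMn⟩)]
      exact hn _ (quantile_le hy.2)
    · rw [indicator_of_notMem hy, norm_zero]
      exact indicator_nonneg (fun _ _ => (abs_nonneg _).trans (hn 0 zero_le)) _
  · have hE := (countable_exceptionalLevels (μ := μ) (T := T) hB).ae_notMem volume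
    filter_upwards [hE] with y hy
    by_cases h0 : y ≤ 0
    · simp [indicator, h0.not_gt]
    rw [not_le] at h0
    rcases lt_trichotomy y (μ.real (Iic T)) with hlt | heq | hgt
    · rw [indicator_of_mem (mem_Ioc.2 ⟨h0, hlt.le⟩)]
      refine (tendsto_comp_quantile hτ hk hM hnb hj hlt hy).congr' ?_
      filter_upwards [hM.eventually_const_lt hlt] with n hn
      rw [indicator_of_mem (mem_Ioc.2 ⟨h0, hn.le⟩)]
    · exact absurd (by simp [exceptionalLevels, heq]) hy
    · rw [indicator_of_notMem fun h => hgt.not_ge (mem_Ioc.1 h).2]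
      refine tendsto_const_nhds.congr' ?_
      filter_upwards [hM.eventually_lt_const hgt] with n hn
      rw [indicator_of_notMem fun h => hn.not_ge (mem_Ioc.1 h).2]

end TimeChange

end

section

variable {m : ℕ} {π : ℕ → Finset ℝ≥0} {Ω : Set (Path m)}

/-! ## Left-convergent sequences of functions -/

/-- The functions `fs n` converge to `f` along all sequences of points that approach their limit
from the left of the partition intervals. -/
def LeftConv (π : ℕ → Finset ℝ≥0) (fs : ℕ → ℝ≥0 → ℝ) (f : ℝ≥0 → ℝ) : Prop :=
  ∀ s, ∀ u : ℕ → ℝ≥0, Tendsto u atTop (𝓝 s) → (∀ᶠ n in atTop, u n ≤ prevPt (π n) s) →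
    Tendsto (fun n => fs n (u n)) atTop (𝓝 (f s))

section LeftConv

variable {fs : ℕ → ℝ≥0 → ℝ} {f : ℝ≥0 → ℝ}

/-- Otherwise bad points at increasing indices can be assembled into one sequence contradicting
`LeftConv`. -/
theorem LeftConv.exists_uniform (hπ : IsPartitionSeq π) (h : LeftConv π fs f) (s : ℝ≥0) {ε : ℝ}
    (hε : 0 < ε) : ∃ δ > 0, ∀ᶠ n in atTop, ∀ u ≤ prevPt (π n) s, dist u s < δ →
      dist (fs n u) (f s) < ε := by
  by_contra! hcon
  have hfreq : ∀ k : ℕ, ∃ᶠ n in atTop, ∃ u ≤ prevPt (π n) s, dist u s < 1 / ((k : ℝ) + 1) ∧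
      ε ≤ dist (fs n u) (f s) := fun k => by
    have := hcon (1 / ((k : ℝ) + 1)) Nat.one_div_pos_of_nat
    simpa [Filter.Frequently, not_eventually] using this
  obtain ⟨σ, hσ, hv⟩ := extraction_forall_of_frequently hfreq
  choose v hv1 hv2 hv3 using hv
  -- The indices without a bad point are filled with `prevPt`, which keeps the sequence admissible
  -- and convergent to `s`.
  set U : ℕ → ℝ≥0 := Function.extend σ v fun n => prevPt (π n) s with hU
  have hUσ : ∀ k, U (σ k) = v k := fun k => hσ.injective.extend_apply _ _ _
  have hUn : ∀ n, (¬∃ k, σ k = n) → U n = prevPt (π n) s := fun n hn =>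
    Function.extend_apply' _ _ _ hn
  have hlim : Tendsto U atTop (𝓝 s) := by
    rw [Metric.tendsto_atTop]
    intro η hη
    obtain ⟨k₀, hk₀⟩ := exists_nat_one_div_lt hη
    obtain ⟨N, hN⟩ := Metric.tendsto_atTop.1 (hπ.tendsto_prevPt s) η hη
    refine ⟨max N (σ k₀), fun n hn => ?_⟩
    by_cases hk : ∃ k, σ k = n
    · obtain ⟨k, rfl⟩ := hk
      rw [hUσ]
      have hkk : k₀ ≤ k := hσ.le_iff_le.1 ((le_max_right _ _).trans hn)
      exact ((hv2 k).trans_le (Nat.one_div_le_one_div hkk)).trans hk₀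
    · rw [hUn n hk]
      exact hN n ((le_max_left _ _).trans hn)
  have hle : ∀ n, U n ≤ prevPt (π n) s := fun n => by
    by_cases hk : ∃ k, σ k = n
    · obtain ⟨k, rfl⟩ := hk
      rw [hUσ]
      exact hv1 k
    · exact (hUn n hk).le
  have hconv := (h s U hlim (Eventually.of_forall hle)).comp hσ.tendsto_atTop
  obtain ⟨k, hk⟩ := (hconv.eventually (Metric.ball_mem_nhds _ hε)).exists
  simp only [Function.comp, hUσ] at hk
  exact (hv3 k).not_gt hk

/-- For fixed precision every bad point `s` is isolated from the left among bad points: just left of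
`s` the values `fs n u`, hence also `f r`, are all close to `f s`. A set of left-isolated points is
countable. -/
theorem LeftConv.countable_not_tendsto (hπ : IsPartitionSeq π) (h : LeftConv π fs f) :
    {s | ¬∀ u : ℕ → ℝ≥0, Tendsto u atTop (𝓝 s) →
      Tendsto (fun n => fs n (u n)) atTop (𝓝 (f s))}.Countable := by
  set Bk : ℕ → Set ℝ≥0 := fun k => {s | ¬∃ δ > 0, ∀ᶠ n in atTop, ∀ u, dist u s < δ →
    dist (fs n u) (f s) < 1 / ((k : ℝ) + 1)} with hBk
  refine (countable_iUnion (t := Bk) fun k => ?_).mono fun s hs => ?_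
  · refine Countable.mono (fun s hs => ?_) (countable_setOfPred_isolated_left_within (s := Bk k))
    refine ⟨hs, ?_⟩
    have hε : 0 < 1 / ((k : ℝ) + 1) := Nat.one_div_pos_of_nat
    obtain ⟨δ, hδ, hN⟩ := h.exists_uniform hπ s (half_pos hε)
    rw [← empty_mem_iff_bot, mem_nhdsWithin]
    refine ⟨Metric.ball s δ, Metric.isOpen_ball, Metric.mem_ball_self hδ, ?_⟩
    rintro r ⟨hr, hrB, hrs⟩
    refine hrB ?_
    rw [Metric.mem_ball] at hr
    have hrs' : r < s := hrs
    -- Staying below the midpoint forces `u ≤ prevPt (π n) s` eventually, so the one-sided uniform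
    -- bound applies on a full neighbourhood of `r`.
    have hev : ∀ᶠ n in atTop, ∀ u, u < (r + s) / 2 → dist u s < δ →
        dist (fs n u) (f s) < 1 / ((k : ℝ) + 1) / 2 := by
      have hmid : (r + s) / 2 < s := by
        rw [div_lt_iff₀ two_pos, mul_two]
        exact add_lt_add_left hrs' s
      filter_upwards [hN, (hπ.tendsto_prevPt s).eventually_const_lt hmid] with n h1 h2 u hu hd
      exact h1 u (hu.trans h2).le hd
    have hmid' : r < (r + s) / 2 := by
      rw [lt_div_iff₀ two_pos, mul_two]
      exact add_lt_add_right hrs' r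
    have hnhds : ∀ᶠ u in 𝓝 r, u < (r + s) / 2 ∧ dist u s < δ :=
      (gt_mem_nhds hmid').and (Metric.isOpen_ball.mem_nhds (Metric.mem_ball.2 hr))
    have hfr : dist (f r) (f s) ≤ 1 / ((k : ℝ) + 1) / 2 := by
      have h1 := h r _ (hπ.tendsto_prevPt r) (Eventually.of_forall fun _ => le_rfl)
      refine le_of_tendsto (h1.dist tendsto_const_nhds) ?_
      filter_upwards [hev, (hπ.tendsto_prevPt r).eventually hnhds] with n h2 h3
      exact (h2 _ h3.1 h3.2).le
    obtain ⟨η, hη, hball⟩ := Metric.eventually_nhds_iff.1 hnhds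
    refine ⟨η, hη, ?_⟩
    filter_upwards [hev] with n hn u hu
    have h4 := hn u (hball hu).1 (hball hu).2
    have h5 := dist_triangle_right (fs n u) (f r) (f s)
    linarith
  · by_contra hcon
    refine hs fun u hu => ?_
    rw [Metric.tendsto_atTop']
    intro ε hε
    obtain ⟨k, hk⟩ := exists_nat_one_div_lt hε
    have hsk : ∃ δ > 0, ∀ᶠ n in atTop, ∀ u, dist u s < δ →
        dist (fs n u) (f s) < 1 / ((k : ℝ) + 1) := by
      by_contra hno
      exact hcon (mem_iUnion.2 ⟨k, hno⟩)
    obtain ⟨δ, hδ, hN⟩ := hsk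
    obtain ⟨N, hN'⟩ := eventually_atTop.1 (hN.and (hu.eventually (Metric.ball_mem_nhds s hδ)))
    exact ⟨N, fun n hn => ((hN' n hn.le).1 _ (hN' n hn.le).2).trans hk⟩

/-- A left-continuous function is the limit of its values at the grid points `⌊(n+1)s⌋/(n+1) ≤ s`.
-/
theorem measurable_of_tendsto_nhdsLE (h : ∀ s, Tendsto f (𝓝[≤] s) (𝓝 (f s))) : Measurable f := by
  refine measurable_of_tendsto_metrizable (f := fun (n : ℕ) (s : ℝ≥0) =>
    f ((⌊((n : ℝ) + 1) * (s : ℝ)⌋₊ : ℝ≥0) / ((n : ℝ≥0) + 1))) (fun n => ?_) ?_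
  · have h1 : Measurable fun k : ℕ => f ((k : ℝ≥0) / ((n : ℝ≥0) + 1)) := measurable_of_countable _
    exact h1.comp (Nat.measurable_floor.comp (measurable_coe_nnreal_real.const_mul _))
  · rw [tendsto_pi_nhds]
    intro s
    refine (h s).comp (tendsto_nhdsWithin_iff.2 ⟨?_, Eventually.of_forall fun n => ?_⟩)
    · have hn : Tendsto (fun n : ℕ => (n : ℝ) + 1) atTop atTop :=
        tendsto_atTop_add_const_right _ _ tendsto_natCast_atTop_atTop
      have h2 := (tendsto_nat_floor_mul_div_atTop (R := ℝ) s.coe_nonneg).comp hn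
      rw [← NNReal.tendsto_coe]
      refine h2.congr fun n => ?_
      simp [Function.comp, mul_comm]
    · rw [mem_Iic, ← NNReal.coe_le_coe]
      push_cast
      rw [div_le_iff₀ (by positivity), mul_comm (s : ℝ)]
      exact Nat.floor_le (by positivity)

end LeftConv

end

section

variable {m : ℕ} {π : ℕ → Finset ℝ≥0} {Ω : Set (Path m)}

/-! ## Stieltjes measures of right-continuous functions -/

section Stieltjes

variable {g : ℝ≥0 → ℝ} (hm : Monotone g) (hc : ∀ t, ContinuousWithinAt g (Ici t) t)
include hm hc

theorem monoMeasure_Ioc (a b : ℝ≥0) :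
    monoMeasure g (Ioc a b) = ENNReal.ofReal (g b - g a) := by
  rw [monoMeasure, dif_pos hm, StieltjesFunction.measure_Ioc, hm.stieltjesFunction_eq,
    hm.stieltjesFunction_eq, (hc a).rightLim_eq, (hc b).rightLim_eq]

omit hc in
theorem isFiniteMeasure_restrict_monoMeasure (T : ℝ≥0) :
    IsFiniteMeasure ((monoMeasure g).restrict (Ioc 0 T)) :=
  ⟨by rw [Measure.restrict_apply_univ, monoMeasure, dif_pos hm, StieltjesFunction.measure_Ioc]
      exact ENNReal.ofReal_lt_top⟩

end Stieltjes

theorem integrableOn_monoMeasure {g f : ℝ≥0 → ℝ} (hm : Monotone g) (hf : Measurable f) {K : ℝ}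
    {T : ℝ≥0} (hK : ∀ s ≤ T, |f s| ≤ K) : IntegrableOn f (Ioc 0 T) (monoMeasure g) := by
  have := isFiniteMeasure_restrict_monoMeasure hm T
  refine Integrable.of_bound hf.aestronglyMeasurable K ?_
  exact (ae_restrict_mem measurableSet_Ioc).mono fun s hs => hK s hs.2

section Polarization

variable {g C D E : ℝ≥0 → ℝ}
  (hC : Monotone C) (hD : Monotone D) (hE : Monotone E)
  (hCc : ∀ t, ContinuousWithinAt C (Ici t) t) (hDc : ∀ t, ContinuousWithinAt D (Ici t) t)
  (hEc : ∀ t, ContinuousWithinAt E (Ici t) t) (hg : ∀ t, g t = (C t - D t - E t) / 2)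

section
include hC hD hE hg

/-- The increments of `g` are dominated by those of the monotone function `C + D + E`. -/
theorem locallyBoundedVariationOn_of_polarization : LocallyBoundedVariationOn g univ := by
  intro a b ha hb
  have hM : Monotone fun t => C t + D t + E t := fun a b h => add_le_add (add_le_add (hC h) (hD h))
    (hE h)
  refine ne_top_of_le_ne_top ((hM.monotoneOn univ).locallyBoundedVariationOn a b ha hb) ?_
  refine iSup_mono fun p => Finset.sum_le_sum fun i _ => ?_
  have hu := p.2.2.1 (Nat.le_succ i)
  have h1 := hC hu
  have h2 := hD hu
  have h3 := hE hu
  rw [edist_dist, edist_dist]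
  refine ENNReal.ofReal_le_ofReal ?_
  rw [Real.dist_eq, Real.dist_eq, abs_of_nonneg (sub_nonneg.2 (hM hu)), hg, hg, abs_le]
  constructor <;> linarith

end

theorem monotone_posVar (h : LocallyBoundedVariationOn g univ) : Monotone (posVar g) :=
  fun a b hab => by
    have := abs_le.1 (variationOnFromTo.abs_sub_le_sub_of_le h (mem_univ 0) (mem_univ a) (mem_univ b) hab)
    simp only [posVar]
    linarith

theorem monotone_negVar (h : LocallyBoundedVariationOn g univ) : Monotone (negVar g) :=
  fun a b hab => by
    have := abs_le.1 (variationOnFromTo.abs_sub_le_sub_of_le h (mem_univ 0) (mem_univ a) (mem_univ b) hab)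
    simp only [negVar]
    linarith

include hC hD hE hCc hDc hEc hg

/-- This is `posVar g - negVar g = (C - D - E) / 2`, arranged without subtraction so that it makes
sense for measures. -/
theorem monoMeasure_polarization :
    monoMeasure (posVar g) + monoMeasure (posVar g) + (monoMeasure D + monoMeasure E) =
      monoMeasure (negVar g) + monoMeasure (negVar g) + monoMeasure C := by
  have hbv := locallyBoundedVariationOn_of_polarization hC hD hE hg
  have hp := monotone_posVar hbv
  have hn := monotone_negVar hbv
  simp only [monoMeasure, dif_pos hp, dif_pos hn, dif_pos hC, dif_pos hD, dif_pos hE,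
    ← StieltjesFunction.measure_add]
  congr 1
  ext t
  simp only [StieltjesFunction.add_apply, Monotone.stieltjesFunction_eq, (hCc t).rightLim_eq,
    (hDc t).rightLim_eq, (hEc t).rightLim_eq]
  have hgc : Tendsto g (𝓝[>] t) (𝓝 ((C t - D t - E t) / 2)) := by
    have h : ContinuousWithinAt (fun t => (C t - D t - E t) / 2) (Ici t) t :=
      (((hCc t).sub (hDc t)).sub (hEc t)).div_const 2
    rw [show g = fun t => (C t - D t - E t) / 2 from funext hg]
    exact h.tendsto.mono_left (nhdsWithin_mono _ Ioi_subset_Ici_self)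
  -- Right-continuity of the variation is not needed: only right limits enter, and `posVar g =
  -- negVar g + g`.
  have h1 : Tendsto (posVar g) (𝓝[>] t)
      (𝓝 (Function.rightLim (negVar g) t + (C t - D t - E t) / 2)) := by
    refine ((hn.tendsto_rightLim t).add hgc).congr fun s => ?_
    simp only [posVar, negVar]
    ring
  rw [rightLim_eq_of_tendsto h1]
  ring

theorem lsIntegral_polarization {f : ℝ≥0 → ℝ} (hf : Measurable f) {K : ℝ} {T : ℝ≥0}
    (hK : ∀ s ≤ T, |f s| ≤ K) :
    LSIntegrable f g T ∧ lsIntegral f g T =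
      ((∫ s in Ioc 0 T, f s ∂(monoMeasure C)) - (∫ s in Ioc 0 T, f s ∂(monoMeasure D)) -
        ∫ s in Ioc 0 T, f s ∂(monoMeasure E)) / 2 := by
  have hbv := locallyBoundedVariationOn_of_polarization hC hD hE hg
  have hp := integrableOn_monoMeasure (monotone_posVar hbv) hf hK
  have hn := integrableOn_monoMeasure (monotone_negVar hbv) hf hK
  have iC := integrableOn_monoMeasure hC hf hK
  have iD := integrableOn_monoMeasure hD hf hK
  have iE := integrableOn_monoMeasure hE hf hK
  refine ⟨⟨hbv, hp, hn⟩, ?_⟩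
  have h := congrArg (fun μ => ∫ s in Ioc 0 T, f s ∂μ)
    (monoMeasure_polarization hC hD hE hCc hDc hEc hg)
  simp only [Measure.restrict_add] at h
  rw [integral_add_measure (Integrable.add_measure hp hp) (Integrable.add_measure iD iE),
    integral_add_measure hp hp, integral_add_measure iD iE,
    integral_add_measure (Integrable.add_measure hn hn) iC, integral_add_measure hn hn] at h
  rw [lsIntegral]
  linarith

end Polarization

end

section

variable {m : ℕ} {π : ℕ → Finset ℝ≥0} {Ω : Set (Path m)}

/-! ## Quadratic sums in a fixed direction -/

/-- The squared increment of `ℓ ∘ x` over the partition interval that starts at `s`. -/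
def sqIncr (P : Finset ℝ≥0) (ℓ : Vec m →L[ℝ] ℝ) (x : Path m) (s : ℝ≥0) : ℝ :=
  ℓ (x (nextPt P s) - x s) ^ 2

/-- The sum of the squared increments of `ℓ ∘ x` up to time `t`. -/
def sqSum (P : Finset ℝ≥0) (ℓ : Vec m →L[ℝ] ℝ) (x : Path m) (t : ℝ≥0) : ℝ :=
  ∑ s ∈ P.filter (fun s => s ≤ t), sqIncr P ℓ x s

theorem sqIncr_nonneg (P : Finset ℝ≥0) (ℓ : Vec m →L[ℝ] ℝ) (x : Path m) (s : ℝ≥0) :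
    0 ≤ sqIncr P ℓ x s := sq_nonneg _

theorem monotone_sqSum (P : Finset ℝ≥0) (ℓ : Vec m →L[ℝ] ℝ) (x : Path m) :
    Monotone (sqSum P ℓ x) := fun _ _ hab =>
  Finset.sum_le_sum_of_subset_of_nonneg
    (fun _ hs => Finset.mem_filter.2 ⟨(Finset.mem_filter.1 hs).1, (Finset.mem_filter.1 hs).2.trans hab⟩)
    fun s _ _ => sqIncr_nonneg P ℓ x s

theorem sqSum_sub_prevPt {P : Finset ℝ≥0} (h0 : 0 ∈ P) (ℓ : Vec m →L[ℝ] ℝ) (x : Path m)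
    {t : ℝ≥0} (ht : 0 < t) :
    sqSum P ℓ x t - sqSum P ℓ x (prevPt P t) = if t ∈ P then sqIncr P ℓ x t else 0 := by
  obtain ⟨-, h2, h3⟩ := prevPt_of_pos h0 ht
  split_ifs with hP
  · have : P.filter (fun s => s ≤ t) = insert t (P.filter (fun s => s ≤ prevPt P t)) := by
      ext q
      simp only [Finset.mem_filter, Finset.mem_insert]
      constructor
      · rintro ⟨hq, hqt⟩
        rcases hqt.eq_or_lt with rfl | hlt
        exacts [Or.inl rfl, Or.inr ⟨hq, h3 q hq hlt⟩]
      · rintro (rfl | ⟨hq, hqp⟩)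
        exacts [⟨hP, le_rfl⟩, ⟨hq, hqp.trans h2.le⟩]
    rw [sqSum, this, Finset.sum_insert (by simp [h2]), sqSum]
    ring
  · have : P.filter (fun s => s ≤ t) = P.filter (fun s => s ≤ prevPt P t) := by
      refine Finset.filter_congr fun q hq => ⟨fun hqt => ?_, fun h => h.trans h2.le⟩
      exact h3 q hq (hqt.lt_of_ne fun h => hP (h ▸ hq))
    rw [sqSum, this, sqSum, sub_self]

theorem sqIncr_eq_zero {P : Finset ℝ≥0} {ℓ : Vec m →L[ℝ] ℝ} {x : Path m} {T s : ℝ≥0}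
    (hx : stopAt x T = x) (hs : s ∈ P) (h : T ≤ s) : sqIncr P ℓ x s = 0 := by
  have h1 : x (nextPt P s) = x T := by rw [← hx, stopAt_of_ge (h.trans (le_nextPt hs)), hx]
  have h2 : x s = x T := by rw [← hx, stopAt_of_ge h, hx]
  simp [sqIncr, h1, h2]

theorem sqSum_eq {P : Finset ℝ≥0} {ℓ : Vec m →L[ℝ] ℝ} {x : Path m} {T s : ℝ≥0}
    (hx : stopAt x T = x) (h : T ≤ s) : sqSum P ℓ x s = sqSum P ℓ x T := by
  symm
  refine Finset.sum_subset (fun q hq => ?_) fun q hq hq' => ?_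
  · rw [Finset.mem_filter] at hq ⊢
    exact ⟨hq.1, hq.2.trans h⟩
  · rw [Finset.mem_filter] at hq hq'
    exact sqIncr_eq_zero hx hq.1 (not_le.1 fun hle => hq' ⟨hq.1, hle⟩).le

section Direction

variable {ℓ : Vec m →L[ℝ] ℝ} {x : Path m} {g : ℝ≥0 → ℝ} {τ : ℕ → ℝ≥0 ≃o ℝ≥0} {T : ℝ≥0}
  (hπ : IsPartitionSeq π) (hx : IsCadlag x)
  (hg : ∀ R : ℝ≥0, TendstoUniformlyOn (fun n s => sqSum (π n) ℓ x (τ n s)) g atTop (Iic R))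

section
include hg

theorem tendsto_sqSum (s : ℝ≥0) : Tendsto (fun n => sqSum (π n) ℓ x (τ n s)) atTop (𝓝 (g s)) :=
  (hg s).tendsto_at (mem_Iic.2 le_rfl)

theorem monotone_of_tendsto_sqSum : Monotone g := fun a b hab =>
  le_of_tendsto_of_tendsto' (tendsto_sqSum hg a) (tendsto_sqSum hg b) fun n =>
    monotone_sqSum _ _ _ ((τ n).monotone hab)

include hπ hx

/-- A time change fixes zero, where the sum is the first squared increment alone. -/
theorem sqSum_limit_zero : g 0 = 0 := by
  refine tendsto_nhds_unique (tendsto_sqSum hg 0) ?_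
  have h := ((ℓ.continuous.tendsto 0).comp (tendsto_increment_zero hπ hx)).pow 2
  rw [map_zero, zero_pow two_ne_zero] at h
  refine h.congr fun n => ?_
  have h1 : τ n 0 = 0 := (τ n).map_bot
  have h2 : (π n).filter (fun s => s ≤ 0) = {0} := by
    ext q
    simp only [Finset.mem_filter, Finset.mem_singleton, nonpos_iff_eq_zero]
    exact ⟨fun h => h.2, fun h => ⟨h ▸ hπ.zero_mem n, h⟩⟩
  rw [sqSum, h1, h2, Finset.sum_singleton]
  rfl

/-- A jump of `g` at `s` forces a squared increment bounded below over the interval starting at `τ n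
s`. Its endpoints both tend to `s`, and `x` varies little on either side of `s`, so the interval
must straddle `s`. -/
theorem eventually_eq_prevPt (hτ : TendstoUniformly (fun n s => τ n s) id atTop) {s : ℝ≥0}
    {c : ℝ} (hc : c < g s) (hcs : ∀ r < s, g r ≤ c) :
    ∀ᶠ n in atTop, τ n s = prevPt (π n) s := by
  rcases eq_zero_or_pos s with rfl | hpos
  · refine Eventually.of_forall fun n => ?_
    rw [prevPt_zero]
    exact (τ n).map_bot
  -- Two approximation errors of a quarter of the gap leave half of it for the increment.
  have hd : 0 < (g s - c) / 4 := by linarith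
  have hlarge : ∀ᶠ n in atTop, τ n s ∈ π n ∧ (g s - c) / 2 ≤ sqIncr (π n) ℓ x (τ n s) := by
    filter_upwards [Metric.tendstoUniformlyOn_iff.1 (hg s) _ hd] with n hn
    have hpos' : 0 < τ n s := by
      rw [← (show τ n 0 = 0 from (τ n).map_bot)]
      exact (τ n).lt_iff_lt.2 hpos
    have hp := (prevPt_of_pos (hπ.zero_mem n) hpos').2.1
    obtain ⟨r, hr⟩ := (τ n).surjective (prevPt (π n) (τ n s))
    have hrs : r < s := (τ n).lt_iff_lt.1 (hr ▸ hp)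
    have h1 := sqSum_sub_prevPt (hπ.zero_mem n) ℓ x hpos'
    rw [← hr] at h1
    have h2 := abs_sub_lt_iff.1 (Real.dist_eq _ _ ▸ hn s (mem_Iic.2 le_rfl))
    have h3 := abs_sub_lt_iff.1 (Real.dist_eq _ _ ▸ hn r hrs.le)
    have h4 := hcs r hrs
    split_ifs at h1 with hm
    · exact ⟨hm, by linarith⟩
    · linarith
  have hτs : Tendsto (fun n => τ n s) atTop (𝓝 s) :=
    tendsto_apply_of_tendstoUniformly_id hτ tendsto_const_nhds
  have hns := hπ.tendsto_nextPt hτs (hlarge.mono fun n h => h.1)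
  set d := Real.sqrt ((g s - c) / 2) with hdef
  have hd2 : 0 < d := Real.sqrt_pos.2 (by linarith)
  have hR : ∀ᶠ r in 𝓝 s, s ≤ r → dist (ℓ (x r)) (ℓ (x s)) < d / 2 :=
    eventually_nhdsWithin_iff.1 (((ℓ.continuous.tendsto _).comp (hx s).1).eventually
      (Metric.ball_mem_nhds _ (half_pos hd2)))
  have hL : ∀ᶠ r in 𝓝 s, r < s → dist (ℓ (x r)) (ℓ (Function.leftLim x s)) < d / 2 :=
    eventually_nhdsWithin_iff.1 (((ℓ.continuous.tendsto _).comp (hx.tendsto_leftLim s)).eventually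
      (Metric.ball_mem_nhds _ (half_pos hd2)))
  filter_upwards [hlarge, hτs.eventually (hR.and hL), hns.eventually (hR.and hL)]
    with n ⟨hm, hn⟩ ⟨hR1, hL1⟩ ⟨hR2, hL2⟩
  have hle := le_nextPt hm
  have hdist : d ≤ dist (ℓ (x (nextPt (π n) (τ n s)))) (ℓ (x (τ n s))) := by
    rw [hdef, Real.dist_eq, ← map_sub]
    exact (Real.sqrt_le_sqrt hn).trans (Real.sqrt_sq_eq_abs _).le
  -- Both endpoints at or after `s`, or both before it, would make the increment smaller than `d`.
  refine (prevPt_eq (hπ.zero_mem n) hm (not_le.1 fun h => ?_) (not_lt.1 fun h => ?_)).symm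
  · have := dist_triangle_right (ℓ (x (nextPt (π n) (τ n s)))) (ℓ (x (τ n s))) (ℓ (x s))
    linarith [hR1 h, hR2 (h.trans hle)]
  · have := dist_triangle_right (ℓ (x (nextPt (π n) (τ n s)))) (ℓ (x (τ n s)))
      (ℓ (Function.leftLim x s))
    linarith [hL1 (hle.trans_lt h), hL2 h]

-- The sums stop growing at `T`, so `g` is constant on `(T,∞)`; right-continuity adds `T` itself.
omit hπ hx in
theorem sqSum_limit_eq (hτ : TendstoUniformly (fun n s => τ n s) id atTop)
    (hgc : ∀ t, ContinuousWithinAt g (Ici t) t) (hT : stopAt x T = x) {s : ℝ≥0} (hs : T ≤ s) :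
    g s = g T := by
  have key : ∀ r, T < r → Tendsto (fun n => sqSum (π n) ℓ x T) atTop (𝓝 (g r)) := fun r hr => by
    refine (tendsto_sqSum hg r).congr' ?_
    have := tendsto_apply_of_tendstoUniformly_id hτ (tendsto_const_nhds (x := r))
    filter_upwards [this.eventually_const_le hr] with n hn
    exact sqSum_eq hT hn
  rcases hs.eq_or_lt with rfl | hlt
  · rfl
  have h1 : Tendsto g (𝓝[>] T) (𝓝 (g T)) :=
    (hgc T).tendsto.mono_left (nhdsWithin_mono _ Ioi_subset_Ici_self)
  refine tendsto_nhds_unique (tendsto_const_nhds.congr' ?_) h1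
  filter_upwards [self_mem_nhdsWithin] with r hr
  exact tendsto_nhds_unique (key s hlt) (key r hr)

end

/-- The measure with an atom of mass `sqIncr P ℓ x s` at each partition point `s ≤ T`. -/
def sqMeasure (P : Finset ℝ≥0) (ℓ : Vec m →L[ℝ] ℝ) (x : Path m) (T : ℝ≥0) : Measure ℝ≥0 :=
  ∑ s ∈ P.filter (fun s => s ≤ T), ENNReal.ofReal (sqIncr P ℓ x s) • Measure.dirac s

theorem sqMeasure_apply (P : Finset ℝ≥0) {A : Set ℝ≥0} (hA : MeasurableSet A) :
    sqMeasure P ℓ x T A = ∑ s ∈ P.filter (fun s => s ≤ T),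
      ENNReal.ofReal (sqIncr P ℓ x s) * A.indicator 1 s := by
  simp [sqMeasure, Measure.finsetSum_apply, Measure.dirac_apply' _ hA]

instance (P : Finset ℝ≥0) : IsFiniteMeasure (sqMeasure P ℓ x T) :=
  ⟨by
    rw [sqMeasure_apply P MeasurableSet.univ]
    exact ENNReal.sum_lt_top.2 fun s _ => by simp⟩

theorem sqMeasure_Ioi (P : Finset ℝ≥0) : sqMeasure P ℓ x T (Ioi T) = 0 := by
  rw [sqMeasure_apply P measurableSet_Ioi]
  refine Finset.sum_eq_zero fun s hs => ?_
  rw [indicator_of_notMem fun h => (mem_Ioi.1 h).not_ge (Finset.mem_filter.1 hs).2, mul_zero]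

theorem sqMeasure_real_Iic (P : Finset ℝ≥0) (hT : stopAt x T = x) (u : ℝ≥0) :
    (sqMeasure P ℓ x T).real (Iic u) = sqSum P ℓ x u := by
  have h : sqMeasure P ℓ x T (Iic u) = ENNReal.ofReal (sqSum P ℓ x u) := by
    rw [sqMeasure_apply P measurableSet_Iic, sqSum,
      ENNReal.ofReal_sum_of_nonneg fun s _ => sqIncr_nonneg P ℓ x s, Finset.sum_filter,
      Finset.sum_filter]
    refine Finset.sum_congr rfl fun s hs => ?_
    by_cases h1 : s ≤ T <;> by_cases h2 : s ≤ u <;> simp [h1, h2]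
    · exact (sqIncr_eq_zero hT hs (not_le.1 h1).le).le
  rw [Measure.real, h, ENNReal.toReal_ofReal]
  exact Finset.sum_nonneg fun s _ => sqIncr_nonneg P ℓ x s

theorem integrable_sqMeasure (P : Finset ℝ≥0) (f : ℝ≥0 → ℝ) :
    Integrable f (sqMeasure P ℓ x T) :=
  integrable_finsetSum_measure.2 fun _ _ =>
    (integrable_dirac (by simp)).smul_measure ENNReal.ofReal_ne_top

theorem integral_sqMeasure (P : Finset ℝ≥0) (f : ℝ≥0 → ℝ) :
    ∫ s, f s ∂(sqMeasure P ℓ x T) =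
      ∑ s ∈ P.filter (fun s => s ≤ T), sqIncr P ℓ x s * f s := by
  rw [sqMeasure, integral_finsetSum_measure]
  · refine Finset.sum_congr rfl fun s _ => ?_
    rw [integral_smul_measure, integral_dirac, ENNReal.toReal_ofReal (sqIncr_nonneg P ℓ x s),
      smul_eq_mul]
  · exact fun s _ => (integrable_dirac (by simp)).smul_measure ENNReal.ofReal_ne_top

theorem tendsto_sum_sqIncr_mul (hπ : IsPartitionSeq π) (hx : IsCadlag x)
    (hτ : TendstoUniformly (fun n s => τ n s) id atTop)
    (hg : ∀ R : ℝ≥0, TendstoUniformlyOn (fun n s => sqSum (π n) ℓ x (τ n s)) g atTop (Iic R))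
    (hgc : ∀ t, ContinuousWithinAt g (Ici t) t) (hT : stopAt x T = x)
    {fs : ℕ → ℝ≥0 → ℝ} {f : ℝ≥0 → ℝ} (hf : LeftConv π fs f) (hfm : Measurable f) {K : ℝ}
    (hK : ∀ᶠ n in atTop, ∀ s ≤ T, |fs n s| ≤ K) :
    Tendsto (fun n => ∑ s ∈ (π n).filter (fun s => s ≤ T), sqIncr (π n) ℓ x s * fs n s) atTop
      (𝓝 (∫ s in Ioc 0 T, f s ∂(monoMeasure g))) := by
  have hgm := monotone_of_tendsto_sqSum hg
  have := isFiniteMeasure_restrict_monoMeasure hgm T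
  -- Since `g` starts at zero and is constant after `T`, it is itself the distribution function of
  -- the restricted measure.
  have hreal : ∀ s, ((monoMeasure g).restrict (Ioc 0 T)).real (Iic s) = g s := fun s => by
    have hset : Iic s ∩ Ioc 0 T = Ioc 0 (min s T) := by
      ext q
      simp only [mem_inter_iff, mem_Iic, mem_Ioc, le_min_iff]
      tauto
    have hmin : g (min s T) = g s := by
      rcases le_total s T with h | h
      · rw [min_eq_left h]
      · rw [min_eq_right h, sqSum_limit_eq hg hτ hgc hT h]
    have h0 := sqSum_limit_zero hπ hx hg
    rw [Measure.real, Measure.restrict_apply measurableSet_Iic, hset, monoMeasure_Ioc hgm hgc,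
      h0, sub_zero, hmin, ENNReal.toReal_ofReal (h0 ▸ hgm zero_le)]
  have hmain := tendsto_integral_of_timeChange (μs := fun n => sqMeasure (π n) ℓ x T)
    (μ := (monoMeasure g).restrict (Ioc 0 T)) (T := T) (τ := τ) (fun n => sqMeasure_Ioi (π n))
    (by
      rw [Measure.restrict_apply measurableSet_Ioi]
      convert measure_empty (μ := monoMeasure g)
      ext q
      simp only [mem_inter_iff, mem_Ioi, mem_Ioc, mem_empty_iff_false, iff_false]
      exact fun h => h.1.not_ge h.2.2)
    hτ
    (fun R => by simpa only [hreal, sqMeasure_real_Iic _ hT] using hg R)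
    (fun n => (integrable_sqMeasure (π n) (fs n)).aestronglyMeasurable) hfm.aestronglyMeasurable hK
    (hf.countable_not_tendsto hπ) (fun s hs => by simpa using hs) fun s c hc hcs => ?_
  · simpa only [integral_sqMeasure] using hmain
  · simp only [hreal] at hc hcs
    refine (hf s _ (hπ.tendsto_prevPt s) (Eventually.of_forall fun _ => le_rfl)).congr' ?_
    filter_upwards [eventually_eq_prevPt hπ hx hg hτ hc hcs] with n hn
    rw [hn]

end Direction

end

section

variable {m : ℕ} {π : ℕ → Finset ℝ≥0} {Ω : Set (Path m)}

/-! ## Integrals with respect to the quadratic variation -/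

theorem isQuadVar_quadVar {x : Path m} (h : HasQuadVar π x) : IsQuadVar π x (quadVar π x) := by
  rw [quadVar, dif_pos h]
  exact h.choose_spec

/-- The evaluation of the coordinate `(i, j)` of an array. -/
def entry (i j : Fin m) : (Fin m → Fin m → ℝ) →L[ℝ] ℝ :=
  (ContinuousLinearMap.proj (R := ℝ) (φ := fun _ : Fin m => ℝ) j).comp
    (ContinuousLinearMap.proj (R := ℝ) (φ := fun _ : Fin m => Fin m → ℝ) i)

theorem sqSum_proj (P : Finset ℝ≥0) (x : Path m) (t : ℝ≥0) (i : Fin m) :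
    sqSum P (EuclideanSpace.proj i) x t = entry i i (quadSum P x t) := by
  simp [sqSum, sqIncr, entry, quadSum, sq]

theorem sqSum_proj_add_proj (P : Finset ℝ≥0) (x : Path m) (t : ℝ≥0) (i j : Fin m) :
    sqSum P (EuclideanSpace.proj i + EuclideanSpace.proj j) x t =
      (entry i i + entry i j + entry j i + entry j j) (quadSum P x t) := by
  simp only [sqSum, sqIncr, entry, quadSum, add_apply,
    ContinuousLinearMap.comp_apply, ContinuousLinearMap.proj_apply, ← Finset.sum_add_distrib]
  refine Finset.sum_congr rfl fun s _ => ?_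
  simp
  ring

theorem sqIncr_polarization (P : Finset ℝ≥0) (x : Path m) (s : ℝ≥0) (i j : Fin m) :
    (x (nextPt P s) - x s) i * (x (nextPt P s) - x s) j =
      (sqIncr P (EuclideanSpace.proj i + EuclideanSpace.proj j) x s -
        sqIncr P (EuclideanSpace.proj i) x s - sqIncr P (EuclideanSpace.proj j) x s) / 2 := by
  simp [sqIncr]
  ring

/-- Polarization into the directions `e_i + e_j`, `e_i` and `e_j`. Convergence of the whole array
provides one time change serving all three. -/
theorem tendsto_sum_incr_mul (hπ : IsPartitionSeq π) {x : Path m} (hx : IsCadlag x)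
    (hQ : HasQuadVar π x) {T : ℝ≥0} (hT : stopAt x T = x) {fs : ℕ → ℝ≥0 → ℝ} {f : ℝ≥0 → ℝ}
    (hf : LeftConv π fs f) (hfm : Measurable f) {K : ℝ}
    (hK : ∀ᶠ n in atTop, ∀ s ≤ T, |fs n s| ≤ K) (i j : Fin m) :
    LSIntegrable f (fun s => quadVar π x s i j) T ∧
    Tendsto (fun n => ∑ s ∈ (π n).filter (fun s => s ≤ T),
      (x (nextPt (π n) s) - x s) i * (x (nextPt (π n) s) - x s) j * fs n s) atTop
      (𝓝 (lsIntegral f (fun s => quadVar π x s i j) T)) := by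
  obtain ⟨hcad, τ, hτ, hunif⟩ := isQuadVar_quadVar hQ
  set G := quadVar π x with hG
  have hdir : ∀ (ℓ : Vec m →L[ℝ] ℝ) (Φ : (Fin m → Fin m → ℝ) →L[ℝ] ℝ),
      (∀ n t, sqSum (π n) ℓ x t = Φ (quadSum (π n) x t)) →
      Monotone (fun s => Φ (G s)) ∧ (∀ t, ContinuousWithinAt (fun s => Φ (G s)) (Ici t) t) ∧
      Tendsto (fun n => ∑ s ∈ (π n).filter (fun s => s ≤ T), sqIncr (π n) ℓ x s * fs n s) atTop
        (𝓝 (∫ s in Ioc 0 T, f s ∂(monoMeasure fun s => Φ (G s)))) := by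
    intro ℓ Φ h
    have hg : ∀ R : ℝ≥0, TendstoUniformlyOn (fun n s => sqSum (π n) ℓ x (τ n s))
        (fun s => Φ (G s)) atTop (Iic R) := fun R => by
      simp only [h]
      exact Φ.uniformContinuous.comp_tendstoUniformlyOn (hunif R)
    have hgc : ∀ t, ContinuousWithinAt (fun s => Φ (G s)) (Ici t) t := fun t =>
      Φ.continuous.continuousAt.comp_continuousWithinAt (hcad t).1
    exact ⟨monotone_of_tendsto_sqSum hg, hgc, tendsto_sum_sqIncr_mul hπ hx hτ hg hgc hT hf hfm hK⟩
  obtain ⟨mC, cC, tC⟩ := hdir _ _ fun n t => sqSum_proj_add_proj (π n) x t i j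
  obtain ⟨mD, cD, tD⟩ := hdir _ _ fun n t => sqSum_proj (π n) x t i
  obtain ⟨mE, cE, tE⟩ := hdir _ _ fun n t => sqSum_proj (π n) x t j
  have hbound : ∀ s ≤ T, |f s| ≤ K := fun s hs => by
    refine le_of_tendsto (hf s _ (hπ.tendsto_prevPt s)
      (Eventually.of_forall fun _ => le_rfl)).abs ?_
    filter_upwards [hK] with n hn
    exact hn _ ((prevPt_le (hπ.zero_mem n)).trans hs)
  -- Symmetry is inherited from the discrete sums, and is needed to isolate the single entry.
  have hsymm : ∀ t, G t i j = G t j i := fun t => by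
    have h1 := (hunif t).tendsto_at (mem_Iic.2 le_rfl)
    have h2 := ((entry i j).continuous.tendsto _).comp h1
    have h3 := ((entry j i).continuous.tendsto _).comp h1
    refine tendsto_nhds_unique h2 (h3.congr fun n => ?_)
    simp [entry, quadSum, mul_comm]
  have hpol : ∀ t, G t i j = ((entry i i + entry i j + entry j i + entry j j) (G t) -
      entry i i (G t) - entry j j (G t)) / 2 := fun t => by
    simp [entry]
    linarith [hsymm t]
  obtain ⟨hint, heq⟩ := lsIntegral_polarization mC mD mE cC cD cE hpol hfm hbound
  refine ⟨hint, ?_⟩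
  rw [heq]
  refine (((tC.sub tD).sub tE).div_const 2).congr fun n => ?_
  rw [← Finset.sum_sub_distrib, ← Finset.sum_sub_distrib, Finset.sum_div]
  refine Finset.sum_congr rfl fun s _ => ?_
  rw [sqIncr_polarization]
  ring

section QVInt

variable {φ ψ : Functional Ω (Vec m)}

theorem prodSum_eq (P : Finset ℝ≥0) (φ ψ : Functional Ω (Vec m)) (t : ℝ≥0) (x : Path m) :
    prodSum P φ ψ t x = ∑ i, ∑ j, ∑ s ∈ P.filter (fun s => s ≤ t),
      (x (nextPt P s) - x s) i * (x (nextPt P s) - x s) j *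
        (ev φ s (stopLeft (pcApprox P x) s) i * ev ψ s (stopLeft (pcApprox P x) s) j) := by
  simp only [prodSum, PiLp.inner_apply, Finset.sum_mul_sum]
  rw [Finset.sum_comm]
  refine Finset.sum_congr rfl fun i _ => ?_
  rw [Finset.sum_comm]
  refine Finset.sum_congr rfl fun j _ => Finset.sum_congr rfl fun s _ => ?_
  simp only [RCLike.inner_apply, conj_trivial]
  ring

/-- Local boundedness concerns `xⁿ_s`; strict causality carries it over to `xⁿ_{s-}`. -/
theorem exists_bound_ev_stopLeft (hΩ : IsGeneric π Ω) (hφ : φ ∈ Lb π Ω) {x : Path m} (hx : x ∈ Ω)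
    (T : ℝ≥0) : ∃ K : ℝ, ∀ᶠ n in atTop, ∀ s ≤ T, ∀ i,
      |ev φ s (stopLeft (pcApprox (π n) x) s) i| ≤ K := by
  obtain ⟨n₀, K, hK⟩ := locBounded_of_mem_Lb hφ x hx T
  refine ⟨K, ?_⟩
  filter_upwards [eventually_ge_atTop n₀, hΩ.eventually_approx_mem hx T] with n hn hmem s hs i
  have h := (strictlyCausal_of_mem_Lb hφ).ev_stopAt hΩ hmem s
  rw [stopAt_stopAt_of_le _ hs, stopLeft_stopAt_of_stopAt_mem hΩ hmem hs] at h
  rw [← h]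
  exact (PiLp.norm_apply_le _ i).trans (hK n hn s hs)

theorem tendsto_prodSum_qvInt (hπ : IsPartitionSeq π) (hΩ : IsGeneric π Ω)
    (hQ : ∀ x ∈ Ω, HasQuadVar π x) (hφ : φ ∈ Lb π Ω) (hψ : ψ ∈ Lb π Ω) (p : Domain Ω) :
    (∀ i j, LSIntegrable
      (fun s => ev φ s (stopLeft p.1.2 s) i * ev ψ s (stopLeft p.1.2 s) j)
      (fun s => quadVar π p.1.2 s i j) p.1.1) ∧
    Tendsto (fun n => prodSum (π n) φ ψ p.1.1 p.1.2) atTop (𝓝 (qvInt π φ ψ p)) := by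
  have hx := hΩ.mem_of_mem_domain p.2
  obtain ⟨K₁, hK₁⟩ := exists_bound_ev_stopLeft hΩ hφ hx p.1.1
  obtain ⟨K₂, hK₂⟩ := exists_bound_ev_stopLeft hΩ hψ hx p.1.1
  have key := fun i j => tendsto_sum_incr_mul hπ (hΩ.cadlag _ hx) (hQ _ hx)
    (stopAt_eq_of_mem_domain p.2)
    (fs := fun n s => ev φ s (stopLeft (pcApprox (π n) p.1.2) s) i *
      ev ψ s (stopLeft (pcApprox (π n) p.1.2) s) j)
    (f := fun s => ev φ s (stopLeft p.1.2 s) i * ev ψ s (stopLeft p.1.2 s) j)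
    (K := K₁ * K₂) ?_ ?_ ?_ i j
  · refine ⟨fun i j => (key i j).1, ?_⟩
    simp only [prodSum_eq, qvInt]
    exact tendsto_finsetSum _ fun i _ => tendsto_finsetSum _ fun j _ => (key i j).2
  · intro s u hu hle
    have h1 := (leftCont_of_mem_Lb hφ).c _ hx s u hu hle
    have h2 := (leftCont_of_mem_Lb hψ).c _ hx s u hu hle
    exact (((EuclideanSpace.proj (𝕜 := ℝ) i).continuous.tendsto _).comp h1).mul
      (((EuclideanSpace.proj (𝕜 := ℝ) j).continuous.tendsto _).comp h2)
  · refine measurable_of_tendsto_nhdsLE fun s => ?_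
    have h1 := (leftCont_of_mem_Lb hφ).a _ hx s
    have h2 := (leftCont_of_mem_Lb hψ).a _ hx s
    exact (((EuclideanSpace.proj (𝕜 := ℝ) i).continuous.tendsto _).comp h1).mul
      (((EuclideanSpace.proj (𝕜 := ℝ) j).continuous.tendsto _).comp h2)
  · filter_upwards [hK₁, hK₂] with n h1 h2 s hs
    rw [abs_mul]
    exact mul_le_mul (h1 s hs i) (h2 s hs j) (abs_nonneg _) ((abs_nonneg _).trans (h1 s hs i))

theorem qvIntegrable_of_mem_Lb (hπ : IsPartitionSeq π) (hΩ : IsGeneric π Ω)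
    (hQ : ∀ x ∈ Ω, HasQuadVar π x) (hφ : φ ∈ Lb π Ω) (hψ : ψ ∈ Lb π Ω) : QVIntegrable π φ ψ :=
  fun p => (tendsto_prodSum_qvInt hπ hΩ hQ hφ hψ p).1

/-- The product rule: `∫φ dx ∫ψ dx = ∫{φ,ψ} dx + ∫φψ' d[x]`. -/
theorem qvInt_eq (hπ : IsPartitionSeq π) (hΩ : IsGeneric π Ω)
    (hQ : ∀ x ∈ Ω, HasQuadVar π x) (hφ : φ ∈ Lb π Ω) (hψ : ψ ∈ Lb π Ω)
    (hb : bracket π φ ψ ∈ Lb π Ω) :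
    qvInt π φ ψ = pathInt π φ * pathInt π ψ - pathInt π (bracket π φ ψ) :=
  funext fun p => tendsto_nhds_unique (tendsto_prodSum_qvInt hπ hΩ hQ hφ hψ p).2
    (tendsto_prodSum hπ hΩ hφ hψ hb p)

end QVInt

end

section

/-! ## Positive semidefinite bilinear forms -/

section SemidefiniteForm

variable {E : Type*} [AddCommGroup E] [Module ℝ E] (B : E →ₗ[ℝ] E →ₗ[ℝ] ℝ)
  (hs : ∀ x y, B x y = B y x) (hp : ∀ x, 0 ≤ B x x)
include hs hp

theorem apply_sq_le (x y : E) : B x y ^ 2 ≤ B x x * B y y := by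
  have h := LinearMap.BilinForm.apply_mul_apply_le_of_forall_zero_le B hp x y
  rwa [hs y x, ← sq] at h

/-- The seminorm of a positive semidefinite symmetric bilinear form. -/
def formSeminorm : Seminorm ℝ E :=
  Seminorm.of (fun x => √(B x x))
    (fun x y => by
      rw [Real.sqrt_le_left (by positivity), add_sq, Real.sq_sqrt (hp x), Real.sq_sqrt (hp y)]
      have h1 : B x y ≤ √(B x x) * √(B y y) := by
        rw [← Real.sqrt_mul (hp x)]
        exact Real.le_sqrt_of_sq_le (apply_sq_le B hs hp x y)
      simp only [map_add, LinearMap.add_apply, hs y x]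
      linarith)
    (fun r x => by
      simp only [map_smul, LinearMap.smul_apply, smul_eq_mul, ← mul_assoc]
      rw [Real.sqrt_mul (mul_self_nonneg r), Real.sqrt_mul_self_eq_abs, Real.norm_eq_abs])

theorem formSeminorm_sq (x : E) : formSeminorm B hs hp x ^ 2 = B x x := Real.sq_sqrt (hp x)

theorem formSeminorm_eq_zero_iff (x : E) : formSeminorm B hs hp x = 0 ↔ B x x = 0 :=
  Real.sqrt_eq_zero (hp x)

/-- By Cauchy–Schwarz a null vector is orthogonal to everything, so the null space is the kernel and
in particular a subspace. -/
theorem mem_ker_iff_apply_self (x : E) : x ∈ LinearMap.ker B ↔ B x x = 0 := by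
  refine ⟨fun h => by rw [LinearMap.mem_ker.1 h, LinearMap.zero_apply], fun h => ?_⟩
  ext y
  have := apply_sq_le B hs hp x y
  rw [h, zero_mul] at this
  simpa using pow_eq_zero_iff two_ne_zero |>.1 (this.antisymm (sq_nonneg _))

omit hp in
theorem ker_le_ker_flip_liftQ :
    LinearMap.ker B ≤ LinearMap.ker ((LinearMap.ker B).liftQ B le_rfl).flip := by
  intro y hy
  rw [LinearMap.mem_ker] at hy ⊢
  ext x
  simp [hs x y, hy]

/-- The inner product on the quotient by the kernel of a positive semidefinite symmetric bilinear
form. -/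
@[reducible] def quotientCore : InnerProductSpace.Core ℝ (E ⧸ LinearMap.ker B) where
  inner a b := (LinearMap.ker B).liftQ _ (ker_le_ker_flip_liftQ B hs) b a
  conj_inner_symm a b := by
    obtain ⟨x, rfl⟩ := Submodule.mkQ_surjective _ a
    obtain ⟨y, rfl⟩ := Submodule.mkQ_surjective _ b
    simp [hs x y]
  re_inner_nonneg a := by
    obtain ⟨x, rfl⟩ := Submodule.mkQ_surjective _ a
    simpa using hp x
  add_left a b c := by simp
  smul_left a b r := by simp
  definite a ha := by
    obtain ⟨x, rfl⟩ := Submodule.mkQ_surjective _ a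
    have : B x x = 0 := by simpa using ha
    rw [← LinearMap.mem_ker, Submodule.ker_mkQ]
    exact (mem_ker_iff_apply_self B hs hp x).2 this

theorem quotientCore_inner (x y : E) :
    (quotientCore B hs hp).inner ((LinearMap.ker B).mkQ x) ((LinearMap.ker B).mkQ y) = B x y :=
  rfl

end SemidefiniteForm

section Operators

variable {m : ℕ} {π : ℕ → Finset ℝ≥0} {Ω : Set (Path m)}

/-- The bilinear form `(F, G) ↦ 𝔼 (F G)`. -/
def productForm (𝔼 : Cpi π Ω →ₗ[ℝ] ℝ) : Cpi π Ω →ₗ[ℝ] Cpi π Ω →ₗ[ℝ] ℝ :=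
  LinearMap.mk₂ ℝ (fun F G => 𝔼 (F * G))
    (fun F F' G => by
      rw [← map_add]
      exact congrArg 𝔼 (Subtype.ext (add_mul (F : Functional Ω ℝ) F' G)))
    (fun r F G => by
      rw [← map_smul]
      exact congrArg 𝔼 (Subtype.ext (smul_mul_assoc r (F : Functional Ω ℝ) G)))
    (fun F G G' => by
      rw [← map_add]
      exact congrArg 𝔼 (Subtype.ext (mul_add (F : Functional Ω ℝ) G G')))
    (fun r F G => by
      rw [← map_smul]
      exact congrArg 𝔼 (Subtype.ext (mul_smul_comm r (F : Functional Ω ℝ) G)))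

variable (hπ : IsPartitionSeq π) (hΩ : IsGeneric π Ω) (ℰ : Submodule ℝ (Functional Ω (Vec m)))
  (hℰ : ∀ φ ∈ ℰ, φ ∈ Lb π Ω)

/-- The integral operator `φ ↦ ∫ φ dx`. -/
def intMap : ℰ →ₗ[ℝ] Functional Ω ℝ where
  toFun φ := pathInt π (φ : Functional Ω (Vec m))
  map_add' φ ψ := pathInt_add hπ hΩ (hℰ _ φ.2) (hℰ _ ψ.2)
  map_smul' r φ := pathInt_smul hπ hΩ (hℰ _ φ.2) r

theorem range_intMap_le_cpi : LinearMap.range (intMap hπ hΩ ℰ hℰ) ≤ Cpi π Ω := by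
  rintro _ ⟨φ, rfl⟩
  exact (pathIntegrable_of_mem_Lb hπ hΩ (hℰ _ φ.2)).cont

variable (hQ : ∀ x ∈ Ω, HasQuadVar π x) (hbr : ∀ φ ∈ ℰ, ∀ ψ ∈ ℰ, bracket π φ ψ ∈ ℰ)

/-- The operator `(φ, ψ) ↦ ∫ φψ' d[x]`. -/
def qvMap : ℰ →ₗ[ℝ] ℰ →ₗ[ℝ] Cpi π Ω := by
  -- Membership in `C_π` and bilinearity are read off the product rule, whose other terms already
  -- have them.
  have heq : ∀ φ ψ : ℰ, qvInt π (φ : Functional Ω (Vec m)) ψ =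
      pathInt π (φ : Functional Ω (Vec m)) * pathInt π (ψ : Functional Ω (Vec m)) -
        pathInt π (bracket π (φ : Functional Ω (Vec m)) ψ) := fun φ ψ =>
    qvInt_eq hπ hΩ hQ (hℰ _ φ.2) (hℰ _ ψ.2) (hℰ _ (hbr _ φ.2 _ ψ.2))
  have hcomm : ∀ φ ψ : ℰ, qvInt π (φ : Functional Ω (Vec m)) ψ =
      qvInt π (ψ : Functional Ω (Vec m)) φ := fun φ ψ => by
    rw [heq, heq, bracket_comm, mul_comm]
  have hadd : ∀ φ φ' ψ : ℰ, qvInt π ((φ + φ' : ℰ) : Functional Ω (Vec m)) ψ =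
      qvInt π (φ : Functional Ω (Vec m)) ψ + qvInt π (φ' : Functional Ω (Vec m)) ψ :=
    fun φ φ' ψ => by
      rw [heq, heq, heq, Submodule.coe_add, pathInt_add hπ hΩ (hℰ _ φ.2) (hℰ _ φ'.2),
        bracket_add_left hπ hΩ (hℰ _ φ.2) (hℰ _ φ'.2),
        pathInt_add hπ hΩ (hℰ _ (hbr _ φ.2 _ ψ.2)) (hℰ _ (hbr _ φ'.2 _ ψ.2))]
      ring
  have hsmul : ∀ (r : ℝ) (φ ψ : ℰ), qvInt π ((r • φ : ℰ) : Functional Ω (Vec m)) ψ =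
      r • qvInt π (φ : Functional Ω (Vec m)) ψ := fun r φ ψ => by
    rw [heq, heq, Submodule.coe_smul, pathInt_smul hπ hΩ (hℰ _ φ.2),
      bracket_smul_left hπ hΩ (hℰ _ φ.2), pathInt_smul hπ hΩ (hℰ _ (hbr _ φ.2 _ ψ.2)), smul_sub,
      smul_mul_assoc]
  exact LinearMap.mk₂ ℝ (fun φ ψ => ⟨qvInt π (φ : Functional Ω (Vec m)) ψ, by
      rw [heq]
      refine sub_mem ?_ (pathIntegrable_of_mem_Lb hπ hΩ (hℰ _ (hbr _ φ.2 _ ψ.2))).cont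
      exact ((⟨_, (pathIntegrable_of_mem_Lb hπ hΩ (hℰ _ φ.2)).cont⟩ : Cpi π Ω) *
        (⟨_, (pathIntegrable_of_mem_Lb hπ hΩ (hℰ _ ψ.2)).cont⟩ : Cpi π Ω)).2⟩)
    (fun φ φ' ψ => Subtype.ext (hadd φ φ' ψ))
    (fun r φ ψ => Subtype.ext (hsmul r φ ψ))
    (fun φ ψ ψ' => Subtype.ext (by
      simp only [Submodule.coe_add]
      rw [← Submodule.coe_add, hcomm, hadd, hcomm ψ, hcomm ψ']))
    (fun r φ ψ => Subtype.ext (by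
      simp only [Submodule.coe_smul]
      rw [← Submodule.coe_smul, hcomm, hsmul, hcomm ψ]))

theorem coe_qvMap (φ ψ : ℰ) : (qvMap hπ hΩ ℰ hℰ hQ hbr φ ψ : Functional Ω ℝ) =
    qvInt π (φ : Functional Ω (Vec m)) ψ := rfl

/-- The product rule under `𝔼`: the bracket lies in `ℰ`, so its integral has expectation zero. -/
theorem map_mul_eq_map_qvMap (𝔼 : Cpi π Ω →ₗ[ℝ] ℝ)
    (hker : ∀ F : Cpi π Ω, (∃ φ ∈ ℰ, (F : Functional Ω ℝ) = pathInt π φ) → 𝔼 F = 0) (φ ψ : ℰ)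
    {X Y : Cpi π Ω} (hX : (X : Functional Ω ℝ) = pathInt π (φ : Functional Ω (Vec m)))
    (hY : (Y : Functional Ω ℝ) = pathInt π (ψ : Functional Ω (Vec m))) :
    𝔼 (X * Y) = 𝔼 (qvMap hπ hΩ ℰ hℰ hQ hbr φ ψ) := by
  have hb := hbr _ φ.2 _ ψ.2
  have h := hker ⟨_, (pathIntegrable_of_mem_Lb hπ hΩ (hℰ _ hb)).cont⟩ ⟨_, hb, rfl⟩
  have hq : X * Y = qvMap hπ hΩ ℰ hℰ hQ hbr φ ψ +
      ⟨_, (pathIntegrable_of_mem_Lb hπ hΩ (hℰ _ hb)).cont⟩ := by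
    refine Subtype.ext ?_
    rw [Submodule.coe_add, coe_qvMap, qvInt_eq hπ hΩ hQ (hℰ _ φ.2) (hℰ _ ψ.2) (hℰ _ hb),
      sub_add_cancel, ← hX, ← hY]
    rfl
  rw [hq, map_add, h, add_zero]

theorem intMap_eq_of_eq_afterZero {φ ψ : ℰ}
    (h : ∀ p : Domain Ω, 0 < p.1.1 → (φ : Functional Ω (Vec m)) p = (ψ : Functional Ω (Vec m)) p) :
    intMap hπ hΩ ℰ hℰ φ = intMap hπ hΩ ℰ hℰ ψ := by
  rw [← sub_eq_zero, ← map_sub]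
  refine pathInt_eq_zero hπ hΩ (leftCont_of_mem_Lb (hℰ _ (φ - ψ).2)) fun p hp => ?_
  rw [Submodule.coe_sub, Pi.sub_apply, h p hp, sub_self]

end Operators

end

end PathwiseCalculus

end

/-! ### The isometry and its inverse -/

open PathwiseCalculus in
theorem mainTheorem12 {m : ℕ} (π : ℕ → Finset ℝ≥0) (hπ : IsPartitionSeq π)
    (Ω : Set (Path m)) (hΩ : IsGeneric π Ω) (hQ : ∀ x ∈ Ω, HasQuadVar π x)
    (ℰ : Submodule ℝ (Functional Ω (Vec m)))
    (hℰ : ∀ φ ∈ ℰ, φ ∈ Lb π Ω)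
    (hbr : ∀ φ ∈ ℰ, ∀ ψ ∈ ℰ, bracket π φ ψ ∈ ℰ)
    (𝔼 : Cpi π Ω →ₗ[ℝ] ℝ)
    (hpos : ∀ F : Cpi π Ω, (∀ p, 0 ≤ (F : Functional Ω ℝ) p) → 0 ≤ 𝔼 F)
    (hker : ∀ F : Cpi π Ω, (∃ φ ∈ ℰ, (F : Functional Ω ℝ) = pathInt π φ) → 𝔼 F = 0) :
    -- the image `I` of `ℰ` under integration, the integral operator `S : φ ↦ ∫ φ dx`, and the map
    -- `Q : (φ, ψ) ↦ ∫ φψ' d[x]`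
    ∃ (I : Submodule ℝ (Functional Ω ℝ)) (hI : I ≤ Cpi π Ω) (S : ℰ →ₗ[ℝ] I)
      (Q : ℰ →ₗ[ℝ] ℰ →ₗ[ℝ] Cpi π Ω),
      (∀ F, F ∈ I ↔ ∃ φ ∈ ℰ, F = pathInt π φ) ∧
      (∀ φ : ℰ, PathIntegrable π (φ : Functional Ω (Vec m)) ∧
        (S φ : Functional Ω ℝ) = pathInt π (φ : Functional Ω (Vec m))) ∧
      (∀ φ ψ : ℰ, QVIntegrable π (φ : Functional Ω (Vec m)) (ψ : Functional Ω (Vec m)) ∧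
        (Q φ ψ : Functional Ω ℝ) =
          qvInt π (φ : Functional Ω (Vec m)) (ψ : Functional Ω (Vec m))) ∧
      -- the isometry formula
      (∀ φ ψ : ℰ, 𝔼 (Submodule.inclusion hI (S φ) * Submodule.inclusion hI (S ψ)) = 𝔼 (Q φ ψ)) ∧
      -- the two brackets induce seminorms
      ∃ (nE : Seminorm ℝ ℰ) (nI : Seminorm ℝ I),
        (∀ φ, nE φ ^ 2 = 𝔼 (Q φ φ)) ∧
        (∀ F, nI F ^ 2 = 𝔼 (Submodule.inclusion hI F * Submodule.inclusion hI F)) ∧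
        -- the null spaces of the seminorms, and the inner products on the quotients
        ∃ (N : Submodule ℝ ℰ) (K : Submodule ℝ I),
          (∀ φ, φ ∈ N ↔ nE φ = 0) ∧ (∀ F, F ∈ K ↔ nI F = 0) ∧
          ∃ (cE : InnerProductSpace.Core ℝ (ℰ ⧸ N)) (cI : InnerProductSpace.Core ℝ (I ⧸ K)),
            (∀ φ ψ : ℰ, cE.inner (N.mkQ φ) (N.mkQ ψ) = 𝔼 (Q φ ψ)) ∧
            (∀ F G : I, cI.inner (K.mkQ F) (K.mkQ G) =
              𝔼 (Submodule.inclusion hI F * Submodule.inclusion hI G)) ∧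
            -- the induced operator is an isometric isomorphism
            ∃ s : (ℰ ⧸ N) ≃ₗ[ℝ] (I ⧸ K),
              (∀ φ : ℰ, s (N.mkQ φ) = K.mkQ (S φ)) ∧
              (∀ a b, cI.inner (s a) (s b) = cE.inner a b) ∧
              -- its inverse is the vertical derivative
              (∀ F : I, ClassMb π (F : Functional Ω ℝ) ∧
                (∃ φ : ℰ, ∀ p : Domain Ω, 0 < p.1.1 →
                  (φ : Functional Ω (Vec m)) p = vertDeriv (F : Functional Ω ℝ) p) ∧
                ∀ φ : ℰ, (∀ p : Domain Ω, 0 < p.1.1 →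
                  (φ : Functional Ω (Vec m)) p = vertDeriv (F : Functional Ω ℝ) p) →
                  s.symm (K.mkQ F) = N.mkQ φ) := by
  have hmul : ∀ F : Cpi π Ω, 0 ≤ 𝔼 (F * F) := fun F =>
    hpos _ fun p => mul_self_nonneg ((F : Functional Ω ℝ) p)
  set J := intMap hπ hΩ ℰ hℰ with hJ
  have hI : LinearMap.range J ≤ Cpi π Ω := range_intMap_le_cpi hπ hΩ ℰ hℰ
  set S : ℰ →ₗ[ℝ] LinearMap.range J := J.rangeRestrict with hS
  set Q := qvMap hπ hΩ ℰ hℰ hQ hbr with hQdef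
  have hiso : ∀ φ ψ : ℰ,
      𝔼 (Submodule.inclusion hI (S φ) * Submodule.inclusion hI (S ψ)) = 𝔼 (Q φ ψ) :=
    fun φ ψ => map_mul_eq_map_qvMap hπ hΩ ℰ hℰ hQ hbr 𝔼 hker φ ψ rfl rfl
  have hcomm : ∀ F G : Cpi π Ω, F * G = G * F := fun F G =>
    Subtype.ext (mul_comm (F : Functional Ω ℝ) G)
  let BE : ℰ →ₗ[ℝ] ℰ →ₗ[ℝ] ℝ := Q.compr₂ 𝔼
  let BI : LinearMap.range J →ₗ[ℝ] LinearMap.range J →ₗ[ℝ] ℝ :=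
    (productForm 𝔼).compl₁₂ (Submodule.inclusion hI) (Submodule.inclusion hI)
  -- The form on `ℰ` is the pullback of the form on the integrals: it inherits symmetry and
  -- positivity, and `S` matches the null spaces.
  have hBE : ∀ φ ψ, BE φ ψ = BI (S φ) (S ψ) := fun φ ψ => (hiso φ ψ).symm
  have hsI : ∀ F G, BI F G = BI G F := fun F G => congrArg 𝔼 (hcomm _ _)
  have hpI : ∀ F, 0 ≤ BI F F := fun F => hmul _
  have hsE : ∀ φ ψ, BE φ ψ = BE ψ φ := fun φ ψ => by rw [hBE, hBE, hsI]
  have hpE : ∀ φ, 0 ≤ BE φ φ := fun φ => by rw [hBE]; exact hpI _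
  have hmem : ∀ φ, φ ∈ LinearMap.ker BE ↔ S φ ∈ LinearMap.ker BI := fun φ => by
    rw [mem_ker_iff_apply_self BE hsE hpE, mem_ker_iff_apply_self BI hsI hpI, hBE]
  have hSsurj : Function.Surjective S := J.surjective_rangeRestrict
  let s₀ : (ℰ ⧸ LinearMap.ker BE) →ₗ[ℝ] (LinearMap.range J ⧸ LinearMap.ker BI) :=
    (LinearMap.ker BE).mapQ (LinearMap.ker BI) S fun φ hφ => (hmem φ).1 hφ
  have hs₀ : Function.Bijective s₀ := by
    constructor
    · rw [← LinearMap.ker_eq_bot, LinearMap.ker_eq_bot']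
      intro a ha
      obtain ⟨φ, rfl⟩ := Submodule.mkQ_surjective _ a
      rw [← LinearMap.mem_ker, Submodule.ker_mkQ, hmem, ← Submodule.ker_mkQ (LinearMap.ker BI)]
      exact ha
    · intro b
      obtain ⟨F, rfl⟩ := Submodule.mkQ_surjective _ b
      obtain ⟨φ, rfl⟩ := hSsurj F
      exact ⟨(LinearMap.ker BE).mkQ φ, rfl⟩
  refine ⟨LinearMap.range J, hI, S, Q, fun F => ?_, fun φ => ?_, fun φ ψ => ?_, hiso,
    formSeminorm BE hsE hpE, formSeminorm BI hsI hpI, formSeminorm_sq BE hsE hpE,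
    formSeminorm_sq BI hsI hpI, LinearMap.ker BE, LinearMap.ker BI, fun φ => ?_, fun F => ?_,
    quotientCore BE hsE hpE, quotientCore BI hsI hpI, quotientCore_inner BE hsE hpE,
    quotientCore_inner BI hsI hpI, LinearEquiv.ofBijective s₀ hs₀, fun φ => rfl, fun a b => ?_,
    fun F => ?_⟩
  · exact ⟨fun ⟨φ, h⟩ => ⟨φ, φ.2, h.symm⟩, fun ⟨φ, hφ, h⟩ => ⟨⟨φ, hφ⟩, h.symm⟩⟩
  · exact ⟨pathIntegrable_of_mem_Lb hπ hΩ (hℰ _ φ.2), rfl⟩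
  · exact ⟨qvIntegrable_of_mem_Lb hπ hΩ hQ (hℰ _ φ.2) (hℰ _ ψ.2), rfl⟩
  · rw [mem_ker_iff_apply_self BE hsE hpE, formSeminorm_eq_zero_iff]
  · rw [mem_ker_iff_apply_self BI hsI hpI, formSeminorm_eq_zero_iff]
  · obtain ⟨φ, rfl⟩ := Submodule.mkQ_surjective _ a
    obtain ⟨ψ, rfl⟩ := Submodule.mkQ_surjective _ b
    exact (hBE φ ψ).symm
  · obtain ⟨ψ, rfl⟩ := hSsurj F
    have hvert : vertDeriv (S ψ : Functional Ω ℝ) = afterZero (ψ : Functional Ω (Vec m)) :=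
      vertDeriv_pathInt hπ hΩ (hℰ _ ψ.2)
    have hafter : ∀ p : Domain Ω, 0 < p.1.1 →
        vertDeriv (S ψ : Functional Ω ℝ) p = (ψ : Functional Ω (Vec m)) p := fun p hp => by
      rw [hvert, afterZero, if_pos hp]
    refine ⟨classMb_pathInt hπ hΩ (hℰ _ ψ.2), ⟨ψ, fun p hp => (hafter p hp).symm⟩, fun φ hφ => ?_⟩
    -- Both agree with the vertical derivative after time zero, and the integral does not see time
    -- zero.
    have hSφ : S φ = S ψ := Subtype.ext <| intMap_eq_of_eq_afterZero hπ hΩ ℰ hℰ fun p hp =>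
      (hφ p hp).trans (hafter p hp)
    rw [LinearEquiv.symm_apply_eq, ← hSφ]
    rfl
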